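/- Consider a loss system with $K$ servers. Customers $n=1,2,\dots$ arrive at the instants $A_n=U_1+\dots+U_n$, where the inter-arrival times $U_n\ge 0$ are i.i.d. with an arbitrary distribution $F$ of mean $1/\lambda\in(0,\infty)$; let $N_t=\#\{n: A_n\le t\}$. The service times $S_n$ are i.i.d. exponential with rate $\mu>0$, and the valuations $V_n>0$ are i.i.d. with finite mean and continuous distribution function $G$; write $\overline G=1-G$. At time $0$ a random number (with arbitrary law on $\{0,\dots,K\}$) of servers is busy, with residual service times that are exponential with rate $\mu$. All these random quantities are mutually independent. Let $\mathbf p=(p_0,\dots,p_{K-1})$ be a vector of finite prices $p_k\ge 0$, and put $p_K=\infty$, $\overline G(p_K)=0$, $G(p_K)=1$. Let $Z_n$ be the number of busy servers seen by customer $n$ just before being admitted or rejected (customers who arrive simultaneously are treated in the order of their indices). Customer $n$ joins, pays $p_{Z_n}$ and occupies a free server during $S_n$ if $V_n\ge p_{Z_n}$; otherwise the customer leaves for good. The revenue until time $t$ is $$R(t)=\sum_{n=1}^{N_t}\sum_{k=0}^{K-1}p_k\,\mathbf 1\{V_n\ge p_k\}\,\mathbf 1\{Z_n=k\}.$$ Then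 $(Z_n)$ is a time-homogeneous Markov chain on $\{0,\dots,K\}$ with transition probabilities $$P_{kj}=\overline G(p_k)\,s_{k+1,j}+G(p_k)\,s_{k,j},\qquad s_{k,j}=\int\binom kj e^{-j\mu x}\,(1-e^{-\mu x})^{k-j}\,dF(x)\quad(s_{k,j}=0\text{ for }j>k),$$ it has exactly one stationary distribution $\pi=(\pi_0,\dots,\pi_K)$, $R(t)$ is integrable for every $t$, and the limiting mean revenue rate $R(K,\mathbf p)=\lim_{t\to\infty}\mathbb E[R(t)]/t$ exists and equals $$R(K,\mathbf p)=\sum_{k=0}^{K-1}\pi_k\,\lambda_k\,p_k,\qquad \lambda_k=\lambda\,\overline G(p_k).$$ -/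

import Mathlib

open MeasureTheory ProbabilityTheory Filter Topology

noncomputable section

namespace LossPricing

/-- The primitive random quantities of a loss system with `K` servers. Customers are numbered
`0, 1, 2, …`. -/
structure Primitives (Ω : Type*) (K : ℕ) where
  /-- number of servers that are busy at time `0` -/
  init : Ω → Fin (K + 1)
  /-- residual service times at time `0`; only those with index `i < init` are used -/
  resid : Fin K → Ω → ℝ
  /-- inter-arrival times: `inter 0` is the time until the first arrival -/
  inter : ℕ → Ω → ℝ
  /-- service time requirements -/
  serv : ℕ → Ω → ℝ
  /-- valuations -/
  val : ℕ → Ω → ℝ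

/-- Labels of the primitive random variables. -/
inductive Source (K : ℕ) : Type
  | init : Source K
  | resid (i : Fin K) : Source K
  | inter (n : ℕ) : Source K
  | serv (n : ℕ) : Source K
  | val (n : ℕ) : Source K

namespace Primitives

variable {Ω : Type*} {K : ℕ}

/-- All primitive random variables as one family of real random variables. -/
def family (D : Primitives Ω K) : Source K → Ω → ℝ
  | .init => fun ω => ((D.init ω : ℕ) : ℝ)
  | .resid i => D.resid i
  | .inter n => D.inter n
  | .serv n => D.serv n
  | .val n => D.val n

/-- Arrival instant of customer `n`. -/
def arrival (D : Primitives Ω K) (n : ℕ) (ω : Ω) : ℝ :=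
  ∑ i ∈ Finset.range (n + 1), D.inter i ω

/-- Number of arrivals up to time `t`. -/
def count (D : Primitives Ω K) (t : ℝ) (ω : Ω) : ℕ :=
  {n : ℕ | D.arrival n ω ≤ t}.ncard

open Classical in
/-- Number of servers that are busy immediately before time `t`, when `s` is the set of the
customers admitted earlier: customer `m` leaves at time `arrival m + serv m`. -/
def occupied (D : Primitives Ω K) (s : Finset ℕ) (t : ℝ) (ω : Ω) : ℕ :=
  (Finset.univ.filter fun i : Fin K => (i : ℕ) < (D.init ω : ℕ) ∧ t ≤ D.resid i ω).card
    + (s.filter fun m => t ≤ D.arrival m ω + D.serv m ω).card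

/-- A customer with valuation `v` who finds `k` busy servers joins: a server is free and the
valuation is at least the price `p k` (in other words the price in state `K` is `∞`). -/
def Joins (p : Fin K → NNReal) (k : ℕ) (v : ℝ) : Prop :=
  ∃ h : k < K, (p ⟨k, h⟩ : ℝ) ≤ v

open Classical in
/-- The set of the admitted customers among the customers `0, …, n - 1`. -/
def admitted (D : Primitives Ω K) (p : Fin K → NNReal) : ℕ → Ω → Finset ℕ
  | 0, _ => ∅
  | n + 1, ω =>
    if Joins p (D.occupied (D.admitted p n ω) (D.arrival n ω) ω) (D.val n ω) then
      insert n (D.admitted p n ω)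
    else D.admitted p n ω

/-- Number of busy servers seen by customer `n`. -/
def seen (D : Primitives Ω K) (p : Fin K → NNReal) (n : ℕ) (ω : Ω) : ℕ :=
  D.occupied (D.admitted p n ω) (D.arrival n ω) ω

open Classical in
/-- Revenue earned until time `t`. -/
def revenue (D : Primitives Ω K) (p : Fin K → NNReal) (t : ℝ) (ω : Ω) : ℝ :=
  ∑ n ∈ Finset.range (D.count t ω), ∑ k : Fin K,
    if (p k : ℝ) ≤ D.val n ω ∧ D.seen p n ω = (k : ℕ) then (p k : ℝ) else 0

/-- The stochastic assumptions: renewal arrivals with inter-arrival law `F` of mean `1 / lam`,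
independent exponential service times of rate `mu` (also for the customers present at time `0`),
i.i.d. positive valuations with finite mean and law `G` with a continuous distribution function,
everything independent of everything else. The initial number of busy servers has an arbitrary
law. -/
structure IsModel [MeasurableSpace Ω] (D : Primitives Ω K) (P : Measure Ω)
    (lam mu : ℝ) (F G : Measure ℝ) : Prop where
  measurable : ∀ a, Measurable (D.family a)
  indep : iIndepFun D.family P
  resid_law : ∀ i, P.map (D.resid i) = expMeasure mu
  inter_law : ∀ n, P.map (D.inter n) = F
  serv_law : ∀ n, P.map (D.serv n) = expMeasure mu
  val_law : ∀ n, P.map (D.val n) = G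
  inter_nonneg : ∀ᵐ x ∂F, 0 ≤ x
  inter_integrable : Integrable (fun x : ℝ => x) F
  inter_mean : ∫ x, x ∂F = 1 / lam
  val_pos : ∀ᵐ x ∂G, 0 < x
  val_integrable : Integrable (fun x : ℝ => x) G
  val_continuous : Continuous (cdf G)

end Primitives

/-- `1 - G(x)`, where `G` is the distribution function of the valuations. -/
def tail (G : Measure ℝ) (x : ℝ) : ℝ := 1 - cdf G x

/-- Probability that a customer who finds `k` busy servers joins; it is `0` for `k = K`. -/
def joinProb {K : ℕ} (G : Measure ℝ) (p : Fin K → NNReal) (k : Fin (K + 1)) : ℝ :=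
  if h : (k : ℕ) < K then tail G (p ⟨k, h⟩) else 0

/-- Probability that, of `k` busy servers with independent exponential services of rate `mu`,
exactly `j` are still busy after one inter-arrival time of law `F` (it is `0` for `j > k`). -/
def survivalProb (mu : ℝ) (F : Measure ℝ) (k j : ℕ) : ℝ :=
  ∫ x, (k.choose j : ℝ) * Real.exp (-mu * x) ^ j * (1 - Real.exp (-mu * x)) ^ (k - j) ∂F

/-- Transition matrix of the number of busy servers seen by successive customers. -/
def transition {K : ℕ} (mu : ℝ) (F G : Measure ℝ) (p : Fin K → NNReal) :
    Matrix (Fin (K + 1)) (Fin (K + 1)) ℝ :=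
  fun k j => joinProb G p k * survivalProb mu F (k + 1) j
    + (1 - joinProb G p k) * survivalProb mu F k j

/-- The sequence `Z` is a time-homogeneous Markov chain on `{0, …, K}` with transition matrix `M`. -/
def IsMarkovChain {Ω : Type*} [MeasurableSpace Ω] {K : ℕ} (P : Measure Ω) (Z : ℕ → Ω → ℕ)
    (M : Matrix (Fin (K + 1)) (Fin (K + 1)) ℝ) : Prop :=
  (∀ n, Measurable (Z n)) ∧ (∀ᵐ ω ∂P, ∀ n, Z n ω ≤ K) ∧
    (∀ k j, 0 ≤ M k j) ∧ (∀ k, ∑ j, M k j = 1) ∧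
    ∀ (n : ℕ) (z : ℕ → Fin (K + 1)),
      P.real {ω | ∀ i ≤ n + 1, Z i ω = (z i : ℕ)}
        = P.real {ω | ∀ i ≤ n, Z i ω = (z i : ℕ)} * M (z n) (z (n + 1))

/-- `π` is a probability vector that is invariant under `M`. -/
def IsStationary {K : ℕ} (M : Matrix (Fin (K + 1)) (Fin (K + 1)) ℝ) (π : Fin (K + 1) → ℝ) : Prop :=
  π ∈ stdSimplex ℝ (Fin (K + 1)) ∧ Matrix.vecMul π M = π

end LossPricing

end

/-! The whole argument rests on memorylessness. Just after an arrival, conditionally on the states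
seen so far and on the set of jobs in service, the residual service times are i.i.d. exponential.
This is expressed without conditional expectations by `ResidualLaw`, a product formula on an event,
and is proved by induction in `IsModel.residualLaw_present`. During an inter-arrival time the jobs
in service are thinned, and the survivors again have i.i.d. exponential residual times
(`ResidualLaw.survivors`). At the arrival either nothing is added or a fresh independent service
time is. The independence needed comes from ordering the primitive variables by `Source.rank`: the
state seen by customer `n` uses only ranks up to `3 * n + 1`, while the valuation has rank `3 * n +
2` and the service time rank `3 * n + 3`. Counting survivors gives a mixed binomial law, hence the
transition probabilities (`IsModel.measure_history_inter_seen`).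

Since the mean inter-arrival time is positive, the system is found empty with positive probability
from every state. Column `0` of the transition matrix is therefore bounded below, and Doeblin's
contraction yields a unique stationary vector to which the laws of the states converge, with no
aperiodicity discussion.

For the revenue, the expected payment of customer `n` converges to `∑ π_k * tail G (p_k) * p_k`, so
its Cesàro means do too. The number of arrivals depends on the payments, but payments lie between
`0` and a constant. Replacing the count by `⌊lam * t⌋₊` thus costs at most a constant times the mean
absolute difference, which is `o(t)`: the strong law gives convergence of the count divided by `t`,
and an exponential moment bound supplies an integrable majorant. -/

namespace LossPricing
open scoped ENNReal

/-! ### Finite stochastic matrices under Doeblin's condition. -/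

section Stochastic

variable {ι : Type*} [Fintype ι]

theorem sum_vecMul_of_sum_row {M : Matrix ι ι ℝ} (h1 : ∀ k, ∑ j, M k j = 1) (d : ι → ℝ) :
    ∑ j, Matrix.vecMul d M j = ∑ k, d k := by
  simp only [Matrix.vecMul, dotProduct]
  rw [Finset.sum_comm]
  simp [← Finset.mul_sum, h1]

/-- Doeblin's contraction estimate. -/
theorem sum_abs_vecMul_le {M : Matrix ι ι ℝ} (h0 : ∀ k j, 0 ≤ M k j)
    (h1 : ∀ k, ∑ j, M k j = 1) {i₀ : ι} {ε : ℝ} (hε : ∀ k, ε ≤ M k i₀) {d : ι → ℝ}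
    (hd : ∑ k, d k = 0) : ∑ j, |Matrix.vecMul d M j| ≤ (1 - ε) * ∑ k, |d k| := by
  classical
  -- Subtracting the same constant from a whole column does not change the action on vectors of sum
  -- zero, while the row sums drop to `1 - ε`.
  set N : ι → ι → ℝ := fun k j => M k j - if j = i₀ then ε else 0 with hN
  have hN0 : ∀ k j, 0 ≤ N k j := by
    intro k j
    by_cases h : j = i₀
    · subst h; simpa [hN] using hε k
    · simpa [hN, h] using h0 k j
  have hN1 : ∀ k, ∑ j, N k j = 1 - ε := by
    intro k; simp [hN, Finset.sum_sub_distrib, h1]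
  have hMN : ∀ j, Matrix.vecMul d M j = ∑ k, d k * N k j := by
    intro j
    simp only [Matrix.vecMul, dotProduct, hN, mul_sub, Finset.sum_sub_distrib, ← Finset.sum_mul,
      hd, zero_mul, sub_zero]
  calc ∑ j, |Matrix.vecMul d M j| ≤ ∑ j, ∑ k, |d k| * N k j := by
        refine Finset.sum_le_sum fun j _ => ?_
        rw [hMN]
        refine (Finset.abs_sum_le_sum_abs _ _).trans_eq (Finset.sum_congr rfl fun k _ => ?_)
        rw [abs_mul, abs_of_nonneg (hN0 k j)]
    _ = (1 - ε) * ∑ k, |d k| := by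
        rw [Finset.sum_comm]
        simp [← Finset.mul_sum, hN1, mul_comm, ← Finset.sum_mul]

/-- Under Doeblin's condition the successive laws converge to every invariant vector of total
mass one. -/
theorem tendsto_law_of_stationary {M : Matrix ι ι ℝ} (h0 : ∀ k j, 0 ≤ M k j)
    (h1 : ∀ k, ∑ j, M k j = 1) {i₀ : ι} {ε : ℝ} (hε0 : 0 < ε) (hε : ∀ k, ε ≤ M k i₀)
    {ρ : ℕ → ι → ℝ} (hρ : ∀ n, ρ (n + 1) = Matrix.vecMul (ρ n) M) {π : ι → ℝ}
    (hπ : Matrix.vecMul π M = π) (hsum : ∑ k, ρ 0 k = ∑ k, π k) (k : ι) :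
    Tendsto (fun n => ρ n k) atTop (𝓝 (π k)) := by
  have hε1 : ε ≤ 1 := by
    refine (hε i₀).trans ?_
    rw [← h1 i₀]
    exact Finset.single_le_sum (f := M i₀) (fun j _ => h0 i₀ j) (Finset.mem_univ _)
  have hs : ∀ n, ∑ k, (ρ n - π) k = 0 := by
    intro n
    have : ∀ n, ∑ k, ρ n k = ∑ k, π k := by
      intro n
      induction n with
      | zero => exact hsum
      | succ n ih => rw [hρ, sum_vecMul_of_sum_row h1, ih]
    simp [Finset.sum_sub_distrib, this]
  have hb : ∀ n, ∑ k, |(ρ n - π) k| ≤ (1 - ε) ^ n * ∑ k, |(ρ 0 - π) k| := by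
    intro n
    induction n with
    | zero => simp
    | succ n ih =>
      have : ρ (n + 1) - π = Matrix.vecMul (ρ n - π) M := by
        rw [Matrix.sub_vecMul, hπ, hρ]
      rw [this]
      refine (sum_abs_vecMul_le h0 h1 hε (hs n)).trans ?_
      rw [pow_succ', mul_assoc]
      exact mul_le_mul_of_nonneg_left ih (by linarith)
  rw [tendsto_iff_norm_sub_tendsto_zero]
  refine squeeze_zero (fun _ => norm_nonneg _) (fun n => ?_)
    (g := fun n => (1 - ε) ^ n * ∑ k, |(ρ 0 - π) k|) ?_
  · refine le_trans ?_ (hb n)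
    exact Finset.single_le_sum (f := fun k => |(ρ n - π) k|) (fun j _ => abs_nonneg _)
      (Finset.mem_univ k)
  · simpa using (tendsto_pow_atTop_nhds_zero_of_lt_one (by linarith)
      (by linarith : 1 - ε < 1)).mul_const (∑ k, |(ρ 0 - π) k|)

/-- Consecutive iterates of a point mass differ by a vector of sum zero, so the contraction makes
them a Cauchy sequence; the limit is invariant by continuity. Uniqueness holds because the same
iterates converge to every invariant probability vector. -/
theorem existsUnique_stationary_of_doeblin {M : Matrix ι ι ℝ} (h0 : ∀ k j, 0 ≤ M k j)
    (h1 : ∀ k, ∑ j, M k j = 1) {i₀ : ι} {ε : ℝ} (hε0 : 0 < ε) (hε : ∀ k, ε ≤ M k i₀) :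
    ∃! π : ι → ℝ, π ∈ stdSimplex ℝ ι ∧ Matrix.vecMul π M = π := by
  classical
  have hε1 : ε ≤ 1 := by
    refine (hε i₀).trans ?_
    rw [← h1 i₀]
    exact Finset.single_le_sum (f := M i₀) (fun j _ => h0 i₀ j) (Finset.mem_univ _)
  let ρ : ℕ → ι → ℝ := fun n => (fun v => Matrix.vecMul v M)^[n] (Pi.single i₀ 1)
  have hρ : ∀ n, ρ (n + 1) = Matrix.vecMul (ρ n) M := fun n =>
    Function.iterate_succ_apply' _ _ _
  have hmem : ∀ n, ρ n ∈ stdSimplex ℝ ι := by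
    intro n
    induction n with
    | zero => exact single_mem_stdSimplex ℝ i₀
    | succ n ih =>
      refine ⟨fun j => ?_, ?_⟩
      · rw [hρ]
        exact Finset.sum_nonneg fun k _ => mul_nonneg (ih.1 k) (h0 k j)
      · rw [hρ, sum_vecMul_of_sum_row h1, ih.2]
  have hb : ∀ n, ∑ k, |(ρ n - ρ (n + 1)) k| ≤ (1 - ε) ^ n * ∑ k, |(ρ 0 - ρ 1) k| := by
    intro n
    induction n with
    | zero => simp
    | succ n ih =>
      have : ρ (n + 1) - ρ (n + 1 + 1) = Matrix.vecMul (ρ n - ρ (n + 1)) M := by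
        rw [Matrix.sub_vecMul, hρ (n + 1), hρ n]
      rw [this]
      refine (sum_abs_vecMul_le h0 h1 hε ?_).trans ?_
      · simp [Finset.sum_sub_distrib, (hmem n).2, (hmem (n + 1)).2]
      · rw [pow_succ', mul_assoc]
        exact mul_le_mul_of_nonneg_left ih (by linarith)
  have hc : CauchySeq ρ := by
    refine cauchySeq_of_le_geometric (1 - ε) (∑ k, |(ρ 0 - ρ 1) k|) (by linarith) fun n => ?_
    rw [dist_pi_le_iff (by
      exact mul_nonneg (Finset.sum_nonneg fun _ _ => abs_nonneg _) (pow_nonneg (by linarith) _))]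
    intro k
    rw [Real.dist_eq, mul_comm]
    exact le_trans (Finset.single_le_sum (f := fun k => |(ρ n - ρ (n + 1)) k|)
      (fun j _ => abs_nonneg _) (Finset.mem_univ k)) (hb n)
  obtain ⟨π, hπ⟩ := cauchySeq_tendsto_of_complete hc
  have hπM : Matrix.vecMul π M = π := by
    have h2 : Tendsto (fun n => ρ (n + 1)) atTop (𝓝 π) := hπ.comp (tendsto_add_atTop_nat 1)
    have hcont : Continuous fun v : ι → ℝ => Matrix.vecMul v M := by fun_prop
    refine tendsto_nhds_unique ((hcont.tendsto π).comp hπ) ?_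
    simpa [Function.comp_def, hρ] using h2
  refine ⟨π, ⟨(isClosed_stdSimplex ℝ ι).mem_of_tendsto hπ (Eventually.of_forall hmem), hπM⟩, ?_⟩
  rintro σ ⟨hσ, hσM⟩
  have hs := tendsto_law_of_stationary h0 h1 hε0 hε hρ hσM (by rw [(hmem 0).2, hσ.2])
  exact tendsto_nhds_unique (tendsto_pi_nhds.2 hs) hπ

end Stochastic

/-! ### Memorylessness of the exponential law. -/

section Exponential

/-- Translating the density by `u` multiplies it by `exp (-r * u)` on the positive half-line; the
condition `u ≤ y` removes what would come from negative arguments. -/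
theorem expMeasure_shift {r : ℝ} {u : ℝ} (hu : 0 ≤ u) {T : Set ℝ} (hT : MeasurableSet T) :
    expMeasure r {y | u ≤ y ∧ y - u ∈ T} = ENNReal.ofReal (Real.exp (-r * u)) * expMeasure r T := by
  have hm : Measurable (exponentialPDF r) := (measurable_exponentialPDFReal r).ennreal_ofReal
  have hd : expMeasure r = volume.withDensity (exponentialPDF r) := rfl
  have hS : MeasurableSet {y : ℝ | u ≤ y ∧ y - u ∈ T} :=
    measurableSet_Ici.inter (hT.preimage (measurable_id.sub_const u))
  rw [hd, withDensity_apply _ hS, withDensity_apply _ hT, ← lintegral_indicator hS,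
    ← lintegral_indicator hT, ← lintegral_add_right_eq_self _ u,
    ← lintegral_const_mul _ (hm.indicator hT)]
  refine lintegral_congr fun z => ?_
  by_cases hz : z ∈ T
  · by_cases h0 : 0 ≤ z
    · have : z + u ∈ {y : ℝ | u ≤ y ∧ y - u ∈ T} := ⟨by linarith, by simpa using hz⟩
      rw [Set.indicator_of_mem this, Set.indicator_of_mem hz, exponentialPDF_of_nonneg h0,
        exponentialPDF_of_nonneg (by linarith), ← ENNReal.ofReal_mul (Real.exp_nonneg _),
        mul_left_comm, ← Real.exp_add]
      ring_nf
    · have : z + u ∉ {y : ℝ | u ≤ y ∧ y - u ∈ T} := fun h => h0 (by linarith [h.1])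
      rw [Set.indicator_of_notMem this, Set.indicator_of_mem hz,
        exponentialPDF_of_neg (not_le.1 h0), mul_zero]
  · have : z + u ∉ {y : ℝ | u ≤ y ∧ y - u ∈ T} := fun h => hz (by simpa using h.2)
    rw [Set.indicator_of_notMem this, Set.indicator_of_notMem hz, mul_zero]

theorem expMeasure_Ici {r : ℝ} (hr : 0 < r) {u : ℝ} (hu : 0 ≤ u) :
    expMeasure r (Set.Ici u) = ENNReal.ofReal (Real.exp (-r * u)) := by
  have := isProbabilityMeasure_expMeasure hr
  simpa [Set.Ici] using expMeasure_shift (r := r) hu MeasurableSet.univ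

theorem expMeasure_Iio {r : ℝ} (hr : 0 < r) {u : ℝ} (hu : 0 ≤ u) :
    expMeasure r (Set.Iio u) = ENNReal.ofReal (1 - Real.exp (-r * u)) := by
  have := isProbabilityMeasure_expMeasure hr
  rw [← Set.compl_Ici, prob_compl_eq_one_sub measurableSet_Ici, expMeasure_Ici hr hu,
    ENNReal.ofReal_sub _ (Real.exp_nonneg _), ENNReal.ofReal_one]

end Exponential

/-! ### Mixed binomial survival probabilities. -/

section Survival

variable {mu : ℝ} {F : Measure ℝ}

theorem exp_neg_mem_Icc (hmu : 0 < mu) {x : ℝ} (hx : 0 ≤ x) :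
    Real.exp (-mu * x) ∈ Set.Icc (0 : ℝ) 1 :=
  ⟨Real.exp_nonneg _, Real.exp_le_one_iff.2 (by nlinarith)⟩

theorem survival_integrand_nonneg (hmu : 0 < mu) {x : ℝ} (hx : 0 ≤ x) (k j : ℕ) :
    0 ≤ (k.choose j : ℝ) * Real.exp (-mu * x) ^ j * (1 - Real.exp (-mu * x)) ^ (k - j) := by
  have h := exp_neg_mem_Icc hmu hx
  have h2 : 0 ≤ 1 - Real.exp (-mu * x) := by linarith [h.2]
  have h1 := h.1
  positivity

theorem integrable_survival [IsProbabilityMeasure F] (hmu : 0 < mu) (hF : ∀ᵐ x ∂F, 0 ≤ x)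
    (k j : ℕ) : Integrable (fun x => (k.choose j : ℝ) * Real.exp (-mu * x) ^ j *
      (1 - Real.exp (-mu * x)) ^ (k - j)) F := by
  refine Integrable.of_bound (C := k.choose j) (by fun_prop) ?_
  filter_upwards [hF] with x hx
  rw [Real.norm_of_nonneg (survival_integrand_nonneg hmu hx k j), mul_assoc]
  have h := exp_neg_mem_Icc hmu hx
  refine mul_le_of_le_one_right (by positivity) ?_
  refine mul_le_one₀ (pow_le_one₀ h.1 h.2) (pow_nonneg (by linarith [h.2]) _)
    (pow_le_one₀ (by linarith [h.2]) (by linarith [h.1]))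

theorem survivalProb_nonneg (hmu : 0 < mu) (hF : ∀ᵐ x ∂F, 0 ≤ x) (k j : ℕ) :
    0 ≤ survivalProb mu F k j :=
  integral_nonneg_of_ae (hF.mono fun _ hx => survival_integrand_nonneg hmu hx k j)

theorem survivalProb_eq_zero {k j : ℕ} (h : k < j) : survivalProb mu F k j = 0 := by
  simp [survivalProb, Nat.choose_eq_zero_of_lt h]

theorem ofReal_survivalProb [IsProbabilityMeasure F] (hmu : 0 < mu) (hF : ∀ᵐ x ∂F, 0 ≤ x)
    (k j : ℕ) : ENNReal.ofReal (survivalProb mu F k j) =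
      k.choose j * ∫⁻ x, ENNReal.ofReal (Real.exp (-mu * x)) ^ j *
        ENNReal.ofReal (1 - Real.exp (-mu * x)) ^ (k - j) ∂F := by
  rw [survivalProb, ofReal_integral_eq_lintegral_ofReal (integrable_survival hmu hF k j)
    (hF.mono fun _ hx => survival_integrand_nonneg hmu hx k j), ← lintegral_const_mul _
    (by fun_prop)]
  refine lintegral_congr_ae (hF.mono fun x hx => ?_)
  have h := exp_neg_mem_Icc hmu hx
  dsimp only
  rw [mul_assoc, ENNReal.ofReal_mul (by positivity), ENNReal.ofReal_mul (pow_nonneg h.1 _),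
    ENNReal.ofReal_pow h.1, ENNReal.ofReal_pow (by linarith [h.2]), ENNReal.ofReal_natCast]

theorem sum_survivalProb [IsProbabilityMeasure F] (hmu : 0 < mu) (hF : ∀ᵐ x ∂F, 0 ≤ x)
    {K k : ℕ} (hk : k ≤ K) : ∑ j : Fin (K + 1), survivalProb mu F k j = 1 := by
  rw [Fin.sum_univ_eq_sum_range (fun j => survivalProb mu F k j),
    ← Finset.sum_subset (Finset.range_mono (Nat.succ_le_succ hk)) (fun j _ hj => ?_)]
  · simp only [survivalProb]
    rw [← integral_finsetSum _ fun j _ => integrable_survival hmu hF k j]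
    have : ∀ x : ℝ, ∑ j ∈ Finset.range (k + 1), (k.choose j : ℝ) * Real.exp (-mu * x) ^ j *
        (1 - Real.exp (-mu * x)) ^ (k - j) = 1 := by
      intro x
      have h := add_pow (Real.exp (-mu * x)) (1 - Real.exp (-mu * x)) k
      rw [add_sub_cancel, one_pow] at h
      refine Eq.trans (Finset.sum_congr rfl fun j _ => ?_) h.symm
      rw [mul_assoc, mul_comm]
    rw [integral_congr_ae (Eventually.of_forall this)]
    simp
  · exact survivalProb_eq_zero (by simpa using hj)

/-- If the integral vanished, `exp (-mu * x)` would be `1` almost everywhere, so `F` would sit at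
`0`, against the positive mean. -/
theorem survivalProb_zero_pos [IsProbabilityMeasure F] (hmu : 0 < mu) (hF : ∀ᵐ x ∂F, 0 ≤ x)
    (hpos : 0 < ∫ x, x ∂F) (k : ℕ) : 0 < survivalProb mu F k 0 := by
  refine lt_of_le_of_ne (survivalProb_nonneg hmu hF k 0) fun h0 => ?_
  rw [survivalProb, eq_comm, integral_eq_zero_iff_of_nonneg_ae
    (hF.mono fun _ hx => survival_integrand_nonneg hmu hx k 0) (integrable_survival hmu hF k 0)]
    at h0
  have : ∀ᵐ x ∂F, x = 0 := by
    filter_upwards [h0, hF] with x hx hx0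
    have h1 : (1 - Real.exp (-mu * x)) ^ k = 0 := by simpa using hx
    have h2 : Real.exp (-mu * x) = 1 := by linarith [eq_zero_of_pow_eq_zero h1]
    rw [Real.exp_eq_one_iff] at h2
    rcases mul_eq_zero.1 h2 with h | h
    · linarith
    · exact h
  rw [integral_congr_ae (g := fun _ => (0 : ℝ)) this] at hpos
  simp at hpos

end Survival

/-! ### The transition matrix is stochastic and satisfies Doeblin's condition. -/

section Transition

variable {mu : ℝ} {F G : Measure ℝ} {K : ℕ} (p : Fin K → NNReal)

theorem joinProb_mem_Icc (G : Measure ℝ) (k : Fin (K + 1)) :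
    joinProb G p k ∈ Set.Icc (0 : ℝ) 1 := by
  unfold joinProb tail
  split_ifs with h
  · exact ⟨by linarith [cdf_le_one G (p ⟨k, h⟩)], by linarith [cdf_nonneg G (p ⟨k, h⟩)]⟩
  · simp

theorem transition_nonneg (hmu : 0 < mu) (hF : ∀ᵐ x ∂F, 0 ≤ x) (k j : Fin (K + 1)) :
    0 ≤ transition mu F G p k j := by
  have h := joinProb_mem_Icc p G k
  exact add_nonneg (mul_nonneg h.1 (survivalProb_nonneg hmu hF _ _))
    (mul_nonneg (by linarith [h.2]) (survivalProb_nonneg hmu hF _ _))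

theorem sum_transition [IsProbabilityMeasure F] (hmu : 0 < mu) (hF : ∀ᵐ x ∂F, 0 ≤ x)
    (k : Fin (K + 1)) : ∑ j, transition mu F G p k j = 1 := by
  simp only [transition, Finset.sum_add_distrib, ← Finset.mul_sum]
  rw [sum_survivalProb hmu hF (Nat.lt_succ_iff.1 k.2)]
  by_cases h : (k : ℕ) < K
  · rw [sum_survivalProb hmu hF h]; ring
  · simp [joinProb, h]

theorem transition_zero_pos [IsProbabilityMeasure F] (hmu : 0 < mu) (hF : ∀ᵐ x ∂F, 0 ≤ x)
    (hpos : 0 < ∫ x, x ∂F) (k : Fin (K + 1)) : 0 < transition mu F G p k 0 := by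
  have h := joinProb_mem_Icc p G k
  have h1 := survivalProb_zero_pos hmu hF hpos (k + 1)
  have h2 := survivalProb_zero_pos hmu hF hpos k
  have : transition mu F G p k 0 = joinProb G p k * survivalProb mu F (k + 1) 0
    + (1 - joinProb G p k) * survivalProb mu F k 0 := rfl
  rw [this]
  rcases h.1.eq_or_lt with h0 | h0
  · rw [← h0]; simpa using h2
  · exact add_pos_of_pos_of_nonneg (mul_pos h0 h1) (mul_nonneg (by linarith [h.2]) h2.le)

theorem exists_doeblin_transition [IsProbabilityMeasure F] (hmu : 0 < mu)
    (hF : ∀ᵐ x ∂F, 0 ≤ x) (hpos : 0 < ∫ x, x ∂F) :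
    ∃ ε > 0, ∀ k, ε ≤ transition mu F G p k 0 := by
  obtain ⟨k₀, hk₀⟩ := Finite.exists_min fun k => transition mu F G p k 0
  exact ⟨_, transition_zero_pos p hmu hF hpos k₀, hk₀⟩

end Transition

/-! ### Measurability of events about surviving subsets. -/

/-- Turns an equality of random sets into one condition per coordinate, the shape to which a product
law applies. -/
theorem filter_eq_iff_of_subset {ι : Type*} {B C : Finset ι} (hC : C ⊆ B) (q : ι → Prop)
    [DecidablePred q] : B.filter q = C ↔ ∀ j ∈ B, (j ∈ C ↔ q j) := by
  constructor
  · rintro rfl j hj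
    simp [hj]
  · intro h
    ext j
    simp only [Finset.mem_filter]
    exact ⟨fun hj => (h j hj.1).2 hj.2, fun hj => ⟨hC hj, (h j (hC hj)).1 hj⟩⟩

theorem measurableSet_inter_forall {Ω ι : Type*} {m : MeasurableSpace Ω} {E : Set Ω}
    {B : Finset ι} {e : ι → Ω → ℝ} (hE : MeasurableSet[m] E) (he : ∀ j ∈ B, Measurable[m] (e j))
    {T : ι → Set ℝ} (hT : ∀ j, MeasurableSet (T j)) :
    MeasurableSet[m] (E ∩ {ω | ∀ j ∈ B, e j ω ∈ T j}) := by
  refine MeasurableSet.inter hE ?_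
  have : {ω | ∀ j ∈ B, e j ω ∈ T j} = ⋂ j ∈ B, e j ⁻¹' T j := by ext; simp
  rw [this]
  exact Finset.measurableSet_biInter B fun j hj => he j hj (hT j)

theorem measurableSet_filter_eq {Ω ι : Type*} [MeasurableSpace Ω] [DecidableEq ι] {B : Finset ι}
    {e : ι → Ω → ℝ} {U : Ω → ℝ} (he : ∀ j ∈ B, Measurable (e j)) (hU : Measurable U)
    (C : Finset ι) : MeasurableSet {ω | B.filter (fun j => U ω ≤ e j ω) = C} := by
  by_cases hC : C ⊆ B
  · have : {ω | B.filter (fun j => U ω ≤ e j ω) = C}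
        = ⋂ j ∈ B, {ω | j ∈ C ↔ U ω ≤ e j ω} := by
      ext ω; simp [filter_eq_iff_of_subset hC]
    rw [this]
    refine Finset.measurableSet_biInter B fun j hj => ?_
    by_cases hjC : j ∈ C
    · simpa [hjC] using measurableSet_le hU (he j hj)
    · simpa [hjC] using measurableSet_lt (he j hj) hU
  · have : {ω | B.filter (fun j => U ω ≤ e j ω) = C} = ∅ :=
      Set.eq_empty_of_forall_notMem fun ω hω => hC (hω ▸ Finset.filter_subset _ _)
    simp [this]

theorem measurable_mem_prodMk {Ω ι : Type*} [MeasurableSpace Ω] {E : Set Ω} {B : Finset ι}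
    {e : ι → Ω → ℝ} (hE : MeasurableSet E) (he : ∀ j ∈ B, Measurable (e j)) :
    Measurable fun ω => ((ω ∈ E, fun j => e j ω) : Prop × (B → ℝ)) :=
  Measurable.prodMk (measurableSet_setOfPred.1 hE) (measurable_pi_iff.2 fun j => he j j.2)

/-! ### Independent residual times on an event, and their thinning. -/

section ResidualLaw

variable {Ω ι : Type*} {m m' : MeasurableSpace Ω} [mΩ : MeasurableSpace Ω] {P : Measure Ω}
  {E A : Set Ω} {B C : Finset ι} {e : ι → Ω → ℝ} {ν : Measure ℝ} {U : Ω → ℝ}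

/-- On the event `E` the variables `e j`, `j ∈ B`, are independent with law `ν`. -/
def ResidualLaw (P : Measure Ω) (E : Set Ω) (B : Finset ι) (e : ι → Ω → ℝ) (ν : Measure ℝ) :
    Prop :=
  ∀ T : ι → Set ℝ, (∀ j, MeasurableSet (T j)) →
    P (E ∩ {ω | ∀ j ∈ B, e j ω ∈ T j}) = P E * ∏ j ∈ B, ν (T j)

theorem measure_eq_tsum_fibers {β : Type*} [Countable β] {X : Ω → β}
    (hX : ∀ b, MeasurableSet {ω | X ω = b}) (A : Set Ω) :
    P A = ∑' b, P (A ∩ {ω | X ω = b}) := by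
  have h : P = Measure.sum fun b => P.restrict {ω | X ω = b} := by
    rw [← Measure.restrict_iUnion _ hX, Set.iUnion_eq_univ_iff.2 fun ω => ⟨X ω, rfl⟩,
      Measure.restrict_univ]
    intro b c hbc
    exact Set.disjoint_left.2 fun ω hb hc => hbc (hb.symm.trans hc)
  conv_lhs => rw [h]
  rw [Measure.sum_apply_of_countable]
  exact tsum_congr fun b => Measure.restrict_apply' (hX b)

/-- The product factor does not depend on the fiber, so the formula adds up over a countable
partition. This permits working with one configuration at a time. -/
theorem ResidualLaw.of_fibers {β : Type*} [Countable β] {X : Ω → β}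
    (hX : ∀ b, MeasurableSet {ω | X ω = b})
    (h : ∀ b, ResidualLaw P (E ∩ {ω | X ω = b}) B e ν) : ResidualLaw P E B e ν := by
  intro T hT
  rw [measure_eq_tsum_fibers hX, measure_eq_tsum_fibers hX E, ← ENNReal.tsum_mul_right]
  refine tsum_congr fun b => ?_
  rw [← h b T hT, Set.inter_right_comm]

theorem ResidualLaw.congr_set {E' : Set Ω} (h : ResidualLaw P E B e ν)
    (hE : ∀ᵐ ω ∂P, ω ∈ E' ↔ ω ∈ E) : ResidualLaw P E' B e ν := by
  intro T hT
  have h1 : E' =ᵐ[P] E := hE.mono fun ω hω => propext hω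
  rw [measure_congr h1, ← h T hT]
  exact measure_congr (h1.inter (ae_eq_refl _))

theorem residualLaw_of_measure_zero (hE : P E = 0) : ResidualLaw P E B e ν := by
  intro T _
  rw [hE, zero_mul]
  exact measure_mono_null Set.inter_subset_left hE

theorem ResidualLaw.inter_indep (h : ResidualLaw P E B e ν) (hE : MeasurableSet[m] E)
    (he : ∀ j ∈ B, Measurable[m] (e j)) (hind : Indep m m' P) (hA : MeasurableSet[m'] A) :
    ResidualLaw P (E ∩ A) B e ν := by
  intro T hT
  rw [Set.inter_right_comm, (Indep_iff _ _ _).1 hind _ _ (measurableSet_inter_forall hE he hT) hA,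
    (Indep_iff _ _ _).1 hind _ _ hE hA, h T hT, mul_right_comm]

theorem ResidualLaw.insert_indep [DecidableEq ι] (h : ResidualLaw P E B e ν) (hE : MeasurableSet[m] E)
    {n : ι} (hn : n ∉ B) (he : ∀ j ∈ B, Measurable[m] (e j))
    (hind : Indep m (MeasurableSpace.comap (e n) inferInstance) P)
    (hlaw : P.map (e n) = ν) (hen : Measurable (e n)) :
    ResidualLaw P E (insert n B) e ν := by
  intro T hT
  have : E ∩ {ω | ∀ j ∈ insert n B, e j ω ∈ T j}
      = (E ∩ {ω | ∀ j ∈ B, e j ω ∈ T j}) ∩ e n ⁻¹' T n := by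
    ext ω
    simp only [Set.mem_inter_iff, Set.mem_ofPred_eq, Finset.forall_mem_insert, Set.mem_preimage]
    tauto
  rw [this, (Indep_iff _ _ _).1 hind _ _ (measurableSet_inter_forall hE he hT)
    ⟨T n, hT n, rfl⟩, h T hT, Finset.prod_insert hn, ← hlaw, Measure.map_apply hen (hT n), hlaw]
  ring

/-- Fubini for the joint law of `U` and the pair formed by the truth value of `E` and the vector of
the `e j`; it freezes the independent time `U` at a constant. -/
theorem measure_inter_eq_lintegral_of_indep [IsProbabilityMeasure P] (hm : m ≤ mΩ)
    (hE : MeasurableSet[m] E)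
    (he : ∀ j ∈ B, Measurable[m] (e j)) (hU : Measurable U)
    (hind : Indep m (MeasurableSpace.comap U inferInstance) P)
    {S : ι → Set (ℝ × ℝ)} (hS : ∀ j, MeasurableSet (S j)) :
    P (E ∩ {ω | ∀ j ∈ B, (e j ω, U ω) ∈ S j})
      = ∫⁻ u, P (E ∩ {ω | ∀ j ∈ B, (e j ω, u) ∈ S j}) ∂(P.map U) := by
  let X : Ω → Prop × (B → ℝ) := fun ω => (ω ∈ E, fun j => e j ω)
  have hX : Measurable[m] X := by exact @measurable_mem_prodMk _ _ m _ _ _ hE he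
  have hXU : IndepFun X U P := by
    rw [IndepFun_iff_Indep]
    exact indep_of_indep_of_le_left hind hX.comap_le
  have hX' : Measurable X := hX.mono hm le_rfl
  have hmap := hXU.map_prod_eq_prod_map_map hX'.aemeasurable hU.aemeasurable
  let Q : Set ((Prop × (B → ℝ)) × ℝ) := {x | x.1.1 ∧ ∀ j : B, (x.1.2 j, x.2) ∈ S j}
  have hQ : MeasurableSet Q := by
    refine MeasurableSet.inter (measurableSet_setOfPred.2 (measurable_fst.comp measurable_fst)) ?_
    have : {x : (Prop × (B → ℝ)) × ℝ | ∀ j : B, (x.1.2 j, x.2) ∈ S j}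
        = ⋂ j : B, {x | (x.1.2 j, x.2) ∈ S j} := by ext; simp
    change MeasurableSet {x : (Prop × (B → ℝ)) × ℝ | ∀ j : B, (x.1.2 j, x.2) ∈ S j}
    rw [this]
    refine MeasurableSet.iInter fun j => ?_
    exact (hS j).preimage (Measurable.prodMk
      ((measurable_pi_apply j).comp (measurable_snd.comp measurable_fst)) measurable_snd)
  have h1 : E ∩ {ω | ∀ j ∈ B, (e j ω, U ω) ∈ S j} = (fun ω => (X ω, U ω)) ⁻¹' Q := by
    ext ω; simp [X, Q]
  have : IsProbabilityMeasure (P.map X) := Measure.isProbabilityMeasure_map hX'.aemeasurable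
  have : IsProbabilityMeasure (P.map U) := Measure.isProbabilityMeasure_map hU.aemeasurable
  rw [h1, ← Measure.map_apply (hX'.prodMk hU) hQ, hmap, Measure.prod_apply_symm hQ]
  refine lintegral_congr fun u => ?_
  rw [Measure.map_apply hX' (hQ.preimage measurable_prodMk_right)]
  congr 1
  ext ω; simp [X, Q]

variable {mu : ℝ} [IsProbabilityMeasure P] [DecidableEq ι]

/-- Memorylessness: the joint law of the set of the survivors and their residual times. -/
theorem ResidualLaw.measure_survivors (hmu : 0 < mu) (h : ResidualLaw P E B e (expMeasure mu))
    (hm : m ≤ mΩ) (hE : MeasurableSet[m] E) (he : ∀ j ∈ B, Measurable[m] (e j))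
    (hU : Measurable U) (hind : Indep m (MeasurableSpace.comap U inferInstance) P)
    (hU0 : ∀ᵐ ω ∂P, 0 ≤ U ω) (hC : C ⊆ B) {T : ι → Set ℝ} (hT : ∀ j, MeasurableSet (T j)) :
    P (E ∩ {ω | B.filter (fun j => U ω ≤ e j ω) = C} ∩ {ω | ∀ j ∈ C, e j ω - U ω ∈ T j})
      = P E * (∫⁻ u, ENNReal.ofReal (Real.exp (-mu * u)) ^ C.card *
          ENNReal.ofReal (1 - Real.exp (-mu * u)) ^ (B.card - C.card) ∂(P.map U)) *
        ∏ j ∈ C, expMeasure mu (T j) := by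
  -- Jobs in `C` outlive `U` with excess in `T j`; the other jobs of `B` must end strictly earlier.
  let S : ι → Set (ℝ × ℝ) := fun j =>
    if j ∈ C then {x | x.2 ≤ x.1 ∧ x.1 - x.2 ∈ T j} else {x | x.1 < x.2}
  have hS : ∀ j, MeasurableSet (S j) := by
    intro j
    by_cases hj : j ∈ C
    · simp only [S, hj, if_true]
      exact (measurableSet_le measurable_snd measurable_fst).inter
        ((hT j).preimage (measurable_fst.sub measurable_snd))
    · simp only [S, hj, if_false]
      exact measurableSet_lt measurable_fst measurable_snd
  have h1 : E ∩ {ω | B.filter (fun j => U ω ≤ e j ω) = C} ∩ {ω | ∀ j ∈ C, e j ω - U ω ∈ T j}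
      = E ∩ {ω | ∀ j ∈ B, (e j ω, U ω) ∈ S j} := by
    rw [Set.inter_assoc]
    congr 1
    ext ω
    simp only [Set.mem_inter_iff, Set.mem_ofPred_eq, filter_eq_iff_of_subset hC]
    constructor
    · rintro ⟨h2, h3⟩ j hj
      by_cases hjC : j ∈ C
      · simpa [S, hjC] using ⟨(h2 j hj).1 hjC, h3 j hjC⟩
      · simpa [S, hjC] using fun h4 => hjC ((h2 j hj).2 h4)
    · intro h2
      refine ⟨fun j hj => ?_, fun j hj => ?_⟩
      · have := h2 j hj
        by_cases hjC : j ∈ C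
        · simp only [S, hjC, if_true, Set.mem_ofPred_eq] at this
          simp [hjC, this.1]
        · simp only [S, hjC, if_false, Set.mem_ofPred_eq] at this
          simp [hjC, this]
      · have := h2 j (hC hj)
        simp only [S, hj, if_true, Set.mem_ofPred_eq] at this
        exact this.2
  rw [h1, measure_inter_eq_lintegral_of_indep hm hE he hU hind hS, mul_assoc,
    ← lintegral_mul_const _ (by fun_prop), ← lintegral_const_mul _ (by fun_prop)]
  refine lintegral_congr_ae ?_
  have hU0' : ∀ᵐ u ∂(P.map U), 0 ≤ u :=
    (ae_map_iff hU.aemeasurable measurableSet_Ici).2 hU0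
  filter_upwards [hU0'] with u hu
  have h2 := h (fun j => (fun y => (y, u)) ⁻¹' S j)
    (fun j => (hS j).preimage measurable_prodMk_right)
  refine h2.trans ?_
  congr 1
  -- Survivors contribute `exp (-mu * u)` times the mass of `T j` by memorylessness; each of the
  -- others contributes `1 - exp (-mu * u)`.
  rw [← Finset.prod_sdiff hC, mul_comm, mul_right_comm]
  congr 1
  · rw [← Finset.prod_const, ← Finset.prod_mul_distrib]
    refine Finset.prod_congr rfl fun j hj => ?_
    rw [← expMeasure_shift hu (hT j)]
    simp [S, hj]
  · rw [← Finset.card_sdiff_of_subset hC, ← Finset.prod_const]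
    refine Finset.prod_congr rfl fun j hj => ?_
    rw [← expMeasure_Iio hmu hu]
    have : j ∉ C := (Finset.mem_sdiff.1 hj).2
    simp [S, this, Set.Iio]

theorem ResidualLaw.survivors (hmu : 0 < mu) (h : ResidualLaw P E B e (expMeasure mu))
    (hm : m ≤ mΩ) (hE : MeasurableSet[m] E) (he : ∀ j ∈ B, Measurable[m] (e j))
    (hU : Measurable U) (hind : Indep m (MeasurableSpace.comap U inferInstance) P)
    (hU0 : ∀ᵐ ω ∂P, 0 ≤ U ω) (C : Finset ι) :
    ResidualLaw P (E ∩ {ω | B.filter (fun j => U ω ≤ e j ω) = C}) C (fun j ω => e j ω - U ω)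
      (expMeasure mu) := by
  have := isProbabilityMeasure_expMeasure hmu
  by_cases hC : C ⊆ B
  · intro T hT
    rw [h.measure_survivors hmu hm hE he hU hind hU0 hC hT]
    -- With no constraint on the residual times, the formula gives the mass of the event itself,
    -- which is the normalising factor.
    have h2 := h.measure_survivors hmu hm hE he hU hind hU0 hC (T := fun _ => Set.univ)
      (fun _ => MeasurableSet.univ)
    simp only [Set.mem_univ, implies_true, Set.ofPred_true, Set.inter_univ, measure_univ,
      Finset.prod_const_one, mul_one] at h2
    rw [h2]
  · refine residualLaw_of_measure_zero ?_
    have : {ω | B.filter (fun j => U ω ≤ e j ω) = C} = ∅ :=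
      Set.eq_empty_of_forall_notMem fun ω hω => hC (hω ▸ Finset.filter_subset _ _)
    simp [this]

/-- The number of the survivors has the mixed binomial law. -/
theorem ResidualLaw.measure_card_survivors (hmu : 0 < mu)
    (h : ResidualLaw P E B e (expMeasure mu))
    (hm : m ≤ mΩ) (hE : MeasurableSet[m] E) (he : ∀ j ∈ B, Measurable[m] (e j))
    (hU : Measurable U) (hind : Indep m (MeasurableSpace.comap U inferInstance) P)
    (hU0 : ∀ᵐ ω ∂P, 0 ≤ U ω) (i : ℕ) :
    P (E ∩ {ω | (B.filter (fun j => U ω ≤ e j ω)).card = i})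
      = P E * ENNReal.ofReal (survivalProb mu (P.map U) B.card i) := by
  have hp := isProbabilityMeasure_expMeasure hmu
  have : IsProbabilityMeasure (P.map U) := Measure.isProbabilityMeasure_map hU.aemeasurable
  have hU0' : ∀ᵐ u ∂(P.map U), 0 ≤ u :=
    (ae_map_iff hU.aemeasurable measurableSet_Ici).2 hU0
  -- All surviving sets of size `i` are equally likely; their number is the binomial coefficient.
  have hset : E ∩ {ω | (B.filter (fun j => U ω ≤ e j ω)).card = i}
      = ⋃ C ∈ B.powersetCard i, E ∩ {ω | B.filter (fun j => U ω ≤ e j ω) = C} := by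
    ext ω
    simp only [Set.mem_inter_iff, Set.mem_ofPred_eq, Set.mem_iUnion, Finset.mem_powersetCard,
      exists_prop]
    constructor
    · rintro ⟨h1, h2⟩
      exact ⟨_, ⟨Finset.filter_subset _ _, h2⟩, h1, rfl⟩
    · rintro ⟨C, ⟨-, h2⟩, h1, rfl⟩
      exact ⟨h1, h2⟩
  rw [hset, measure_biUnion_finset]
  · have h2 : ∀ C ∈ B.powersetCard i,
        P (E ∩ {ω | B.filter (fun j => U ω ≤ e j ω) = C})
        = P E * (∫⁻ u, ENNReal.ofReal (Real.exp (-mu * u)) ^ i *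
          ENNReal.ofReal (1 - Real.exp (-mu * u)) ^ (B.card - i) ∂(P.map U)) := by
      intro C hC
      rw [Finset.mem_powersetCard] at hC
      have h2 := h.measure_survivors hmu hm hE he hU hind hU0 hC.1 (T := fun _ => Set.univ)
        (fun _ => MeasurableSet.univ)
      simpa [hC.2] using h2
    rw [Finset.sum_congr rfl h2, Finset.sum_const, Finset.card_powersetCard,
      ofReal_survivalProb hmu hU0', nsmul_eq_mul]
    ring
  · intro C _ C' _ hne
    exact Set.disjoint_left.2 fun ω h1 h2 => hne (h1.2.symm.trans h2.2)
  · intro C _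
    exact (hm _ hE).inter (measurableSet_filter_eq (fun j hj => (he j hj).mono hm le_rfl) hU C)

end ResidualLaw

theorem measurableSet_finset_eq {Ω ι : Type*} [MeasurableSpace Ω] [Countable ι]
    {X : Ω → Finset ι} (hX : ∀ j, MeasurableSet {ω | j ∈ X ω}) (C : Finset ι) :
    MeasurableSet {ω | X ω = C} := by
  have : {ω | X ω = C} = ⋂ j, {ω | j ∈ X ω ↔ j ∈ C} := by
    ext ω; simp [Finset.ext_iff]
  rw [this]
  refine MeasurableSet.iInter fun j => ?_
  by_cases hj : j ∈ C
  · simpa [hj] using hX j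
  · simp only [hj, iff_false]
    exact (hX j).compl

theorem measurableSet_joins {K : ℕ} (p : Fin K → NNReal) (k : ℕ) :
    MeasurableSet {v : ℝ | Primitives.Joins p k v} := by
  by_cases h : k < K
  · simp only [Primitives.Joins, h, exists_true_left]
    exact measurableSet_Ici
  · simp only [Primitives.Joins, h, IsEmpty.exists_iff]
    exact MeasurableSet.empty

/-- The order in which the primitive random quantities are used. -/
def Source.rank {K : ℕ} : Source K → ℕ
  | .init => 0
  | .resid _ => 0
  | .inter n => 3 * n + 1
  | .val n => 3 * n + 2
  | .serv n => 3 * n + 3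

namespace Primitives

variable {Ω : Type*} {K : ℕ}

/-! ### σ-algebras generated by the primitive variables. -/

section Sources

variable (D : Primitives Ω K)

/-- The σ-algebra generated by the primitive random variables with labels in `S`. -/
abbrev sourceAlg (S : Set (Source K)) : MeasurableSpace Ω :=
  ⨆ a ∈ S, MeasurableSpace.comap (D.family a) inferInstance

/-- The information contained in the primitive random variables of rank at most `r`. -/
abbrev level (r : ℕ) : MeasurableSpace Ω := D.sourceAlg {a | a.rank ≤ r}

theorem measurable_family_sourceAlg {S : Set (Source K)} {a : Source K} (ha : a ∈ S) :
    Measurable[D.sourceAlg S] (D.family a) :=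
  Measurable.of_comap_le (le_iSup₂_of_le a ha le_rfl)

theorem measurable_family_level (r : ℕ) (a : Source K) (ha : a.rank ≤ r) :
    Measurable[D.level r] (D.family a) :=
  D.measurable_family_sourceAlg (S := {a | a.rank ≤ r}) ha

variable {D} [mΩ : MeasurableSpace Ω] {P : Measure Ω} {lam mu : ℝ} {F G : Measure ℝ}

theorem IsModel.sourceAlg_le (hD : D.IsModel P lam mu F G) (S : Set (Source K)) :
    D.sourceAlg S ≤ mΩ :=
  iSup₂_le fun a _ => (hD.measurable a).comap_le

theorem IsModel.level_le (hD : D.IsModel P lam mu F G) (r : ℕ) : D.level r ≤ mΩ :=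
  hD.sourceAlg_le _

theorem IsModel.indep_sourceAlg (hD : D.IsModel P lam mu F G) {S : Set (Source K)}
    {a : Source K} (ha : a ∉ S) :
    Indep (D.sourceAlg S) (MeasurableSpace.comap (D.family a) inferInstance) P := by
  have h := indep_iSup_of_disjoint (fun a => (hD.measurable a).comap_le)
    hD.indep.iIndep (Set.disjoint_singleton_right.2 ha)
  simpa [sourceAlg] using h

theorem IsModel.indep_level (hD : D.IsModel P lam mu F G) {r : ℕ} {a : Source K}
    (ha : r < a.rank) :
    Indep (D.level r) (MeasurableSpace.comap (D.family a) inferInstance) P :=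
  hD.indep_sourceAlg (S := {a | a.rank ≤ r}) (by simpa using ha)

end Sources

/-! ### Pathwise recursion for the jobs in service. -/

section Dynamics

variable (D : Primitives Ω K) (p : Fin K → NNReal)

/-- The instant of the arrival that precedes customer `n`. -/
def prior (n : ℕ) (ω : Ω) : ℝ := ∑ i ∈ Finset.range n, D.inter i ω

/-- Departure instants of the initial and of the arriving customers. -/
def departure : Fin K ⊕ ℕ → Ω → ℝ
  | .inl i => D.resid i
  | .inr m => fun ω => D.arrival m ω + D.serv m ω

/-- Residual times at the arrival that precedes customer `n`. -/
def residual (n : ℕ) (j : Fin K ⊕ ℕ) (ω : Ω) : ℝ := D.departure j ω - D.prior n ω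

open Classical in
/-- The jobs in service immediately before the arrival of customer `n`. -/
noncomputable def busy (n : ℕ) (ω : Ω) : Finset (Fin K ⊕ ℕ) :=
  (Finset.univ.filter fun i : Fin K =>
      (i : ℕ) < (D.init ω : ℕ) ∧ D.arrival n ω ≤ D.resid i ω).disjSum
    ((D.admitted p n ω).filter fun m => D.arrival n ω ≤ D.arrival m ω + D.serv m ω)

open Classical in
/-- The jobs in service immediately after the arrival that precedes customer `n`. -/
noncomputable def present : ℕ → Ω → Finset (Fin K ⊕ ℕ)
  | 0, ω => (Finset.univ.filter fun i : Fin K => (i : ℕ) < (D.init ω : ℕ)).disjSum ∅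
  | n + 1, ω =>
    if Joins p (D.seen p n ω) (D.val n ω) then insert (.inr n) (D.busy p n ω) else D.busy p n ω

theorem arrival_eq_prior_succ (n : ℕ) (ω : Ω) : D.arrival n ω = D.prior (n + 1) ω := rfl

theorem prior_succ (n : ℕ) (ω : Ω) : D.prior (n + 1) ω = D.prior n ω + D.inter n ω :=
  Finset.sum_range_succ _ _

theorem residual_succ (n : ℕ) :
    D.residual (n + 1) = fun j ω => D.residual n j ω - D.inter n ω := by
  funext j ω
  simp only [residual, prior_succ]
  ring

theorem residual_succ_inr (n : ℕ) : D.residual (n + 1) (.inr n) = D.serv n := by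
  funext ω
  simp [residual, departure, arrival_eq_prior_succ]

theorem card_busy (n : ℕ) (ω : Ω) : (D.busy p n ω).card = D.seen p n ω := by
  rw [busy, Finset.card_disjSum]
  rfl

theorem inl_mem_busy {n : ℕ} {ω : Ω} {i : Fin K} : Sum.inl i ∈ D.busy p n ω ↔
    (i : ℕ) < (D.init ω : ℕ) ∧ D.arrival n ω ≤ D.resid i ω := by
  simp [busy]

theorem inr_mem_busy {n m : ℕ} {ω : Ω} : Sum.inr m ∈ D.busy p n ω ↔
    m ∈ D.admitted p n ω ∧ D.arrival n ω ≤ D.arrival m ω + D.serv m ω := by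
  simp [busy]

theorem mem_admitted_succ {n m : ℕ} {ω : Ω} : m ∈ D.admitted p (n + 1) ω ↔
    m ∈ D.admitted p n ω ∨ (m = n ∧ Joins p (D.seen p n ω) (D.val n ω)) := by
  rw [admitted]
  split_ifs with h
  · have h' : Joins p (D.seen p n ω) (D.val n ω) := h
    simp [h', or_comm]
  · have h' : ¬ Joins p (D.seen p n ω) (D.val n ω) := h
    simp [h']

theorem mem_present_succ {n : ℕ} {j : Fin K ⊕ ℕ} {ω : Ω} : j ∈ D.present p (n + 1) ω ↔
    j ∈ D.busy p n ω ∨ (j = .inr n ∧ Joins p (D.seen p n ω) (D.val n ω)) := by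
  rw [present]
  split_ifs with h <;> simp [h, or_comm]

theorem inl_mem_present_zero {ω : Ω} {i : Fin K} : Sum.inl i ∈ D.present p 0 ω ↔
    (i : ℕ) < (D.init ω : ℕ) := by
  simp [present]

theorem inr_notMem_present_zero {ω : Ω} {m : ℕ} : Sum.inr m ∉ D.present p 0 ω := by
  simp [present]

theorem lt_of_mem_admitted {n m : ℕ} {ω : Ω} (h : m ∈ D.admitted p n ω) : m < n := by
  induction n with
  | zero => simp [admitted] at h
  | succ n ih =>
    rcases (D.mem_admitted_succ p).1 h with h | h
    · exact (ih h).trans n.lt_succ_self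
    · omega

theorem lt_of_inr_mem_busy {n m : ℕ} {ω : Ω} (h : Sum.inr m ∈ D.busy p n ω) : m < n :=
  D.lt_of_mem_admitted p ((D.inr_mem_busy p).1 h).1

theorem lt_of_inr_mem_present {n m : ℕ} {ω : Ω} (h : Sum.inr m ∈ D.present p n ω) : m < n := by
  cases n with
  | zero => exact absurd h (D.inr_notMem_present_zero p)
  | succ n =>
    rcases (D.mem_present_succ p).1 h with h | h
    · exact (D.lt_of_inr_mem_busy p h).trans n.lt_succ_self
    · have := Sum.inr.inj h.1
      omega

/-- `busy` is computed from all customers ever admitted, whereas the induction needs a one-step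
recursion. The two agree because arrival instants are nondecreasing: a job still there at an arrival
was there at the preceding one. -/
theorem busy_eq_filter_present {ω : Ω} (hω : ∀ n, 0 ≤ D.inter n ω) (n : ℕ) :
    D.busy p n ω = (D.present p n ω).filter fun j => D.inter n ω ≤ D.residual n j ω := by
  have key : ∀ j, D.inter n ω ≤ D.residual n j ω ↔ D.arrival n ω ≤ D.departure j ω := by
    intro j
    rw [arrival_eq_prior_succ, prior_succ, residual]
    constructor <;> intro h <;> linarith
  ext j
  rw [Finset.mem_filter, key]
  cases n with
  | zero =>
    rcases j with i | m
    · rw [inl_mem_busy, inl_mem_present_zero]; rfl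
    · rw [inr_mem_busy]
      simp [admitted, inr_notMem_present_zero]
  | succ n =>
    have hle : D.arrival n ω ≤ D.arrival (n + 1) ω := by
      rw [arrival_eq_prior_succ, arrival_eq_prior_succ, prior_succ D (n + 1)]
      linarith [hω (n + 1)]
    rw [mem_present_succ]
    rcases j with i | m
    · rw [inl_mem_busy, inl_mem_busy]
      simp only [departure, reduceCtorEq, false_and, or_false]
      constructor
      · rintro ⟨h1, h2⟩; exact ⟨⟨h1, hle.trans h2⟩, h2⟩
      · rintro ⟨⟨h1, -⟩, h2⟩; exact ⟨h1, h2⟩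
    · rw [inr_mem_busy, inr_mem_busy, mem_admitted_succ]
      simp only [departure, Sum.inr.injEq]
      constructor
      · rintro ⟨h1 | h1, h2⟩
        · exact ⟨Or.inl ⟨h1, hle.trans h2⟩, h2⟩
        · exact ⟨Or.inr h1, h2⟩
      · rintro ⟨⟨h1, -⟩ | h1, h2⟩
        · exact ⟨Or.inl h1, h2⟩
        · exact ⟨Or.inr h1, h2⟩

theorem card_present_succ (n : ℕ) (ω : Ω) [Decidable (Joins p (D.seen p n ω) (D.val n ω))] :
    (D.present p (n + 1) ω).card =
      if Joins p (D.seen p n ω) (D.val n ω) then D.seen p n ω + 1 else D.seen p n ω := by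
  rw [present]
  split_ifs with h
  · rw [Finset.card_insert_of_notMem fun h => lt_irrefl _ (D.lt_of_inr_mem_busy p h), card_busy]
  · rw [card_busy]

theorem seen_le {ω : Ω} (hω : ∀ n, 0 ≤ D.inter n ω) (n : ℕ) : D.seen p n ω ≤ K := by
  classical
  induction n with
  | zero =>
    rw [seen, occupied]
    simp only [admitted, Finset.filter_empty, Finset.card_empty, add_zero]
    exact (Finset.card_le_univ _).trans_eq (Fintype.card_fin K)
  | succ n ih =>
    rw [← card_busy, busy_eq_filter_present D p hω]
    refine (Finset.card_filter_le _ _).trans ?_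
    rw [card_present_succ]
    split_ifs with h
    · exact h.1
    · exact ih

end Dynamics

/-! ### Which primitive variables determine the states. -/

section Measurability

variable [MeasurableSpace Ω] {D : Primitives Ω K} (p : Fin K → NNReal) {r : ℕ}

/-- The σ-algebra is left arbitrary here and below: only sources up to rank `r` need be measurable.
The results therefore apply both to the ambient σ-algebra and to `level r`. -/
theorem measurable_prior (hr : ∀ a : Source K, a.rank ≤ r → Measurable (D.family a)) {n : ℕ}
    (hn : 3 * n ≤ r + 2) : Measurable (D.prior n) := by
  refine Finset.measurable_fun_sum _ fun i hi => hr (.inter i) ?_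
  have := Finset.mem_range.1 hi
  simp only [Source.rank]; omega

theorem measurableSet_lt_init (hr : ∀ a : Source K, a.rank ≤ r → Measurable (D.family a))
    (i : ℕ) : MeasurableSet {ω | i < (D.init ω : ℕ)} := by
  have h : Measurable (D.family .init) := hr .init (Nat.zero_le _)
  have := measurableSet_lt (measurable_const (a := (i : ℝ))) h
  simpa [family] using this

theorem measurable_departure (hr : ∀ a : Source K, a.rank ≤ r → Measurable (D.family a))
    {n : ℕ} (hn : 3 * n ≤ r) {j : Fin K ⊕ ℕ} (hj : ∀ m, j = .inr m → m < n) :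
    Measurable (D.departure j) := by
  rcases j with i | m
  · exact hr (.resid i) (Nat.zero_le _)
  · have := hj m rfl
    exact (measurable_prior hr (n := m + 1) (by omega)).add
      (hr (.serv m) (by simp only [Source.rank]; omega))

theorem measurableSet_joins_seen {X : Ω → ℕ} (hX : Measurable X) {V : Ω → ℝ}
    (hV : Measurable V) : MeasurableSet {ω | Joins p (X ω) (V ω)} := by
  have : {ω | Joins p (X ω) (V ω)} = ⋃ k, {ω | X ω = k} ∩ V ⁻¹' {v | Joins p k v} := by
    ext ω; simp
  rw [this]
  exact MeasurableSet.iUnion fun k =>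
    (measurableSet_eq_fun hX measurable_const).inter (hV (measurableSet_joins p k))

/-- Admissions and observed states are defined through each other; taking the admissions as a
hypothesis (`hadm`) breaks the circle, which the induction in `measurableSet_mem_admitted` closes.
-/
theorem measurableSet_mem_busy_of_admitted
    (hr : ∀ a : Source K, a.rank ≤ r → Measurable (D.family a)) {n : ℕ} (hn : 3 * n + 1 ≤ r)
    (hadm : ∀ m, MeasurableSet {ω | m ∈ D.admitted p n ω}) (j : Fin K ⊕ ℕ) :
    MeasurableSet {ω | j ∈ D.busy p n ω} := by
  have harr : Measurable (D.arrival n) := measurable_prior hr (n := n + 1) (by omega)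
  rcases j with i | m
  · simp only [inl_mem_busy]
    exact (measurableSet_lt_init hr i).inter
      (measurableSet_le harr (hr (.resid i) (Nat.zero_le _)))
  · by_cases hm : m < n
    · simp only [inr_mem_busy]
      exact (hadm m).inter (measurableSet_le harr
        (measurable_departure hr (n := n) (by omega) (j := .inr m) (by simpa using hm)))
    · convert MeasurableSet.empty
      exact Set.eq_empty_of_forall_notMem fun ω h => hm (D.lt_of_inr_mem_busy p h)

theorem measurable_card_of_mem {ι : Type*} [Countable ι] {X : Ω → Finset ι}
    (hX : ∀ j, MeasurableSet {ω | j ∈ X ω}) : Measurable fun ω => (X ω).card := by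
  refine measurable_to_countable' fun k => ?_
  have : (fun ω => (X ω).card) ⁻¹' {k} = ⋃ C : Finset ι, ⋃ _ : C.card = k, {ω | X ω = C} := by
    ext ω; simp
  rw [this]
  exact MeasurableSet.iUnion fun C => MeasurableSet.iUnion fun _ => measurableSet_finset_eq hX C

theorem measurable_seen_of_admitted
    (hr : ∀ a : Source K, a.rank ≤ r → Measurable (D.family a)) {n : ℕ} (hn : 3 * n + 1 ≤ r)
    (hadm : ∀ m, MeasurableSet {ω | m ∈ D.admitted p n ω}) : Measurable (D.seen p n) := by
  have : D.seen p n = fun ω => (D.busy p n ω).card := funext fun ω => (D.card_busy p n ω).symm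
  rw [this]
  exact measurable_card_of_mem (measurableSet_mem_busy_of_admitted p hr hn hadm)

theorem measurableSet_mem_admitted
    (hr : ∀ a : Source K, a.rank ≤ r → Measurable (D.family a)) {n : ℕ} (hn : 3 * n ≤ r)
    (m : ℕ) : MeasurableSet {ω | m ∈ D.admitted p n ω} := by
  induction n generalizing m with
  | zero => simp [admitted]
  | succ n ih =>
    have ih' := fun m => ih (by omega) m
    simp only [mem_admitted_succ]
    refine (ih' m).union ?_
    by_cases hm : m = n
    · simpa only [hm, true_and] using! measurableSet_joins_seen p
        (measurable_seen_of_admitted p hr (by omega) ih')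
        (hr (.val n) (by simp only [Source.rank]; omega))
    · simp only [hm, false_and]
      exact MeasurableSet.empty

theorem measurable_seen (hr : ∀ a : Source K, a.rank ≤ r → Measurable (D.family a)) {n : ℕ}
    (hn : 3 * n + 1 ≤ r) : Measurable (D.seen p n) :=
  measurable_seen_of_admitted p hr hn (measurableSet_mem_admitted p hr (by omega))

theorem measurableSet_busy_eq (hr : ∀ a : Source K, a.rank ≤ r → Measurable (D.family a))
    {n : ℕ} (hn : 3 * n + 1 ≤ r) (C : Finset (Fin K ⊕ ℕ)) :
    MeasurableSet {ω | D.busy p n ω = C} :=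
  measurableSet_finset_eq (measurableSet_mem_busy_of_admitted p hr hn
    (measurableSet_mem_admitted p hr (by omega))) C

theorem measurableSet_present_eq (hr : ∀ a : Source K, a.rank ≤ r → Measurable (D.family a))
    {n : ℕ} (hn : 3 * n ≤ r) (C : Finset (Fin K ⊕ ℕ)) :
    MeasurableSet {ω | D.present p n ω = C} := by
  refine measurableSet_finset_eq (fun j => ?_) C
  cases n with
  | zero =>
    rcases j with i | m
    · simpa only [inl_mem_present_zero] using measurableSet_lt_init hr i
    · simp [inr_notMem_present_zero]
  | succ n =>
    simp only [mem_present_succ]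
    refine (measurableSet_mem_busy_of_admitted p hr (by omega)
      (measurableSet_mem_admitted p hr (by omega)) j).union ?_
    by_cases hj : j = .inr n
    · simpa only [hj, true_and] using! measurableSet_joins_seen p
        (measurable_seen p hr (by omega)) (hr (.val n) (by simp only [Source.rank]; omega))
    · simp only [hj, false_and]
      exact MeasurableSet.empty

theorem measurableSet_history (hr : ∀ a : Source K, a.rank ≤ r → Measurable (D.family a))
    {n : ℕ} (hn : 3 * n ≤ r + 2) (A : ℕ → Set ℕ) :
    MeasurableSet {ω | ∀ i < n, D.seen p i ω ∈ A i} := by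
  have : {ω | ∀ i < n, D.seen p i ω ∈ A i} = ⋂ i, ⋂ _ : i < n, D.seen p i ⁻¹' A i := by
    ext; simp
  rw [this]
  exact MeasurableSet.iInter fun i => MeasurableSet.iInter fun hi =>
    measurable_seen p hr (by omega) (MeasurableSet.of_discrete)

end Measurability

end Primitives

/-! ### Propagation of the residual law and the Markov property. -/

namespace Primitives

section

variable {Ω : Type*} {K : ℕ} {D : Primitives Ω K} (p : Fin K → NNReal)

theorem measurable_residual {_ : MeasurableSpace Ω} {r : ℕ}
    (hr : ∀ a : Source K, a.rank ≤ r → Measurable (D.family a))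
    {n : ℕ} (hn : 3 * n ≤ r) {j : Fin K ⊕ ℕ} (hj : ∀ m, j = .inr m → m < n) :
    Measurable (D.residual n j) :=
  (measurable_departure hr hn hj).sub (measurable_prior hr (by omega))

theorem measurable_residual_succ {_ : MeasurableSpace Ω} {r : ℕ}
    (hr : ∀ a : Source K, a.rank ≤ r → Measurable (D.family a))
    {n : ℕ} (hn : 3 * n + 1 ≤ r) {j : Fin K ⊕ ℕ} (hj : ∀ m, j = .inr m → m < n) :
    Measurable (D.residual (n + 1) j) :=
  (measurable_departure hr (n := n) (by omega) hj).sub (measurable_prior hr (by omega))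

/-- The event that the customers with index less than `n` see states in the sets `A i`. -/
abbrev history (D : Primitives Ω K) (A : ℕ → Set ℕ) (n : ℕ) : Set Ω :=
  {ω | ∀ i < n, D.seen p i ω ∈ A i}

theorem history_succ (D : Primitives Ω K) (A : ℕ → Set ℕ) (n : ℕ) :
    D.history p A (n + 1) = D.history p A n ∩ {ω | D.seen p n ω ∈ A n} := by
  ext ω
  simp only [history, Set.mem_ofPred_eq, Set.mem_inter_iff, Nat.forall_lt_succ_right]

end

variable {Ω : Type*} {K : ℕ} {D : Primitives Ω K} (p : Fin K → NNReal) [mΩ : MeasurableSpace Ω]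
  {P : Measure Ω} {lam mu : ℝ} {F G : Measure ℝ}

theorem IsModel.measurable_of_rank (hD : D.IsModel P lam mu F G) (r : ℕ) (a : Source K)
    (_ : a.rank ≤ r) : Measurable (D.family a) := hD.measurable a

theorem IsModel.inter_nonneg_ae (hD : D.IsModel P lam mu F G) :
    ∀ᵐ ω ∂P, ∀ n, 0 ≤ D.inter n ω := by
  refine ae_all_iff.2 fun n => ?_
  have h := hD.inter_nonneg
  rw [← hD.inter_law n] at h
  exact (ae_map_iff (hD.measurable (.inter n)).aemeasurable measurableSet_Ici).1 h

theorem IsModel.seen_le_ae (hD : D.IsModel P lam mu F G) : ∀ᵐ ω ∂P, ∀ n, D.seen p n ω ≤ K :=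
  hD.inter_nonneg_ae.mono fun _ hω => D.seen_le p hω

theorem IsModel.measurable_seen (hD : D.IsModel P lam mu F G) (n : ℕ) :
    Measurable (D.seen p n) :=
  Primitives.measurable_seen p (hD.measurable_of_rank (3 * n + 1)) le_rfl

theorem IsModel.residualLaw_zero (hD : D.IsModel P lam mu F G) (B : Finset (Fin K ⊕ ℕ)) :
    ResidualLaw P {ω | D.present p 0 ω = B} B (D.residual 0) (expMeasure mu) := by
  classical
  by_cases hB : ∃ ω, D.present p 0 ω = B
  swap
  · push Not at hB
    refine residualLaw_of_measure_zero ?_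
    simp [hB]
  obtain ⟨ω₀, hω₀⟩ := hB
  have hinl : ∀ j ∈ B, ∃ i, j = Sum.inl i := by
    rintro (i | m) hj
    · exact ⟨i, rfl⟩
    · rw [← hω₀] at hj
      exact absurd hj (D.inr_notMem_present_zero p)
  have hres : ∀ i, D.residual 0 (Sum.inl i) = D.family (.resid i) := by
    intro i; funext ω; simp [residual, departure, prior, family]
  have hE : ∀ S : Set (Source K), Source.init ∈ S →
      MeasurableSet[D.sourceAlg S] {ω | D.present p 0 ω = B} := by
    intro S hS
    have hi := D.measurable_family_sourceAlg hS
    -- The initial set of jobs is a function of the initial number alone.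
    have : {ω | D.present p 0 ω = B} = D.family .init ⁻¹'
        ((fun k : ℕ => (k : ℝ)) '' {k | ∃ ω, (D.init ω : ℕ) = k ∧ D.present p 0 ω = B}) := by
      ext ω
      simp only [Set.mem_ofPred_eq, Set.mem_preimage, Set.mem_image]
      constructor
      · intro h
        exact ⟨_, ⟨ω, rfl, h⟩, rfl⟩
      · rintro ⟨k, ⟨ω', h1, h2⟩, h3⟩
        have h4 : (D.init ω' : ℕ) = D.init ω := by
          rw [h1]; exact Nat.cast_injective (R := ℝ) h3
        rw [← h2, present, present, h4]
    rw [this]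
    exact hi ((Set.Countable.image (Set.to_countable _) _).measurableSet)
  have key : ∀ B' ⊆ B, ResidualLaw P {ω | D.present p 0 ω = B} B' (D.residual 0)
      (expMeasure mu) := by
    intro B'
    induction B' using Finset.induction_on with
    | empty => intro _ T _; simp
    | insert j B' hj ih =>
      intro hsub
      obtain ⟨i, rfl⟩ := hinl j (hsub (Finset.mem_insert_self _ _))
      -- All initial residual times share rank `0`, so no `level` separates them; `S` contains just
      -- the sources used so far.
      let S : Set (Source K) := {a | a = .init ∨ ∃ i, Sum.inl i ∈ B' ∧ a = .resid i}
      refine (ih ((Finset.subset_insert _ _).trans hsub)).insert_indep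
        (m := D.sourceAlg S) (hE S (Or.inl rfl)) hj ?_ ?_ ?_ ?_
      · intro j' hj'
        obtain ⟨i', rfl⟩ := hinl j' (hsub (Finset.mem_insert_of_mem hj'))
        rw [hres]
        exact D.measurable_family_sourceAlg (Or.inr ⟨i', hj', rfl⟩)
      · rw [hres]
        refine hD.indep_sourceAlg ?_
        rintro (h | ⟨i', hi', h⟩)
        · cases h
        · cases h
          exact hj hi'
      · rw [hres]; exact hD.resid_law i
      · rw [hres]; exact hD.measurable _
  exact key B subset_rfl

variable [IsProbabilityMeasure P]

theorem IsModel.residualLaw_busy (hD : D.IsModel P lam mu F G) (hmu : 0 < mu) {n : ℕ}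
    {A : ℕ → Set ℕ}
    (h : ∀ B, ResidualLaw P (D.history p A n ∩ {ω | D.present p n ω = B}) B (D.residual n)
      (expMeasure mu)) (C : Finset (Fin K ⊕ ℕ)) :
    ResidualLaw P (D.history p A n ∩ {ω | D.busy p n ω = C}) C (D.residual (n + 1))
      (expMeasure mu) := by
  refine ResidualLaw.of_fibers (X := D.present p n)
    (measurableSet_present_eq p (hD.measurable_of_rank (3 * n)) le_rfl) fun B => ?_
  by_cases hB : ∀ m, Sum.inr m ∈ B → m < n
  swap
  · refine residualLaw_of_measure_zero (measure_mono_null (t := ∅) (fun ω hω => ?_) measure_empty)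
    exact (hB fun m hm => D.lt_of_inr_mem_present p (hω.2.symm ▸ hm)).elim
  have hr := D.measurable_family_level (3 * n)
  rw [residual_succ]
  refine ((h B).survivors hmu (hD.level_le (3 * n)) ?_ ?_ (hD.measurable (.inter n))
    (hD.indep_level (a := .inter n) (by simp [Source.rank])) ?_ C).congr_set ?_
  · exact (@measurableSet_history _ _ (D.level (3 * n)) _ p _ hr n (by omega) A).inter
      (@measurableSet_present_eq _ _ (D.level (3 * n)) _ p _ hr n le_rfl B)
  · intro j hj
    exact measurable_residual hr le_rfl fun m hm => hB m (hm ▸ hj)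
  · exact hD.inter_nonneg_ae.mono fun ω hω => hω n
  · filter_upwards [hD.inter_nonneg_ae] with ω hω
    simp only [Set.mem_inter_iff, Set.mem_ofPred_eq, D.busy_eq_filter_present p hω n]
    constructor
    · rintro ⟨⟨h1, h2⟩, h3⟩
      subst h3
      exact ⟨⟨h1, rfl⟩, h2⟩
    · rintro ⟨⟨h1, h3⟩, h2⟩
      subst h3
      exact ⟨⟨h1, h2⟩, rfl⟩

/-- Once the busy set is fixed to `C`, customer `n` sees `C.card`, so the extra condition on the
history is either automatic or impossible. -/
theorem IsModel.residualLaw_busy_history (hD : D.IsModel P lam mu F G) (hmu : 0 < mu) {n : ℕ}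
    {A : ℕ → Set ℕ}
    (h : ∀ B, ResidualLaw P (D.history p A n ∩ {ω | D.present p n ω = B}) B (D.residual n)
      (expMeasure mu)) (C : Finset (Fin K ⊕ ℕ)) :
    ResidualLaw P (D.history p A (n + 1) ∩ {ω | D.busy p n ω = C}) C (D.residual (n + 1))
      (expMeasure mu) := by
  by_cases hC : C.card ∈ A n
  · refine (hD.residualLaw_busy p hmu h C).congr_set (Eventually.of_forall fun ω => ?_)
    rw [history_succ]
    simp only [Set.mem_inter_iff, Set.mem_ofPred_eq, ← D.card_busy p n ω]
    constructor
    · rintro ⟨⟨h1, -⟩, h2⟩; exact ⟨h1, h2⟩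
    · rintro ⟨h1, h2⟩; exact ⟨⟨h1, h2 ▸ hC⟩, h2⟩
  · refine residualLaw_of_measure_zero (measure_mono_null (t := ∅) (fun ω hω => ?_) measure_empty)
    rw [history_succ] at hω
    obtain ⟨⟨-, h1⟩, h2⟩ := hω
    refine hC ?_
    rw [← show D.busy p n ω = C from h2, card_busy]
    exact h1

theorem IsModel.residualLaw_present_succ (hD : D.IsModel P lam mu F G) (hmu : 0 < mu) {n : ℕ}
    {A : ℕ → Set ℕ}
    (h : ∀ B, ResidualLaw P (D.history p A n ∩ {ω | D.present p n ω = B}) B (D.residual n)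
      (expMeasure mu)) (B : Finset (Fin K ⊕ ℕ)) :
    ResidualLaw P (D.history p A (n + 1) ∩ {ω | D.present p (n + 1) ω = B}) B
      (D.residual (n + 1)) (expMeasure mu) := by
  have hr0 := hD.measurable_of_rank (3 * n + 2)
  refine ResidualLaw.of_fibers (X := D.busy p n)
    (measurableSet_busy_eq p hr0 (by omega)) fun C => ?_
  -- With the busy set `C` and the decision of customer `n` both fixed, only one value of `B` is
  -- possible; for any other the event is empty.
  refine ResidualLaw.of_fibers (X := fun ω => Joins p (D.seen p n ω) (D.val n ω))
    (fun q => ?_) fun q => ?_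
  · have hJ := measurableSet_joins_seen p (Primitives.measurable_seen p hr0 (n := n) (by omega))
      (V := D.val n) (hD.measurable (.val n))
    by_cases hq : q
    · simpa only [hq, eq_iff_iff, iff_true] using hJ
    · simp only [hq, eq_iff_iff, iff_false]
      exact hJ.compl
  by_cases hC : ∀ m, Sum.inr m ∈ C → m < n
  swap
  · refine residualLaw_of_measure_zero (measure_mono_null (t := ∅) (fun ω hω => ?_) measure_empty)
    exact (hC fun m hm => D.lt_of_inr_mem_busy p (hω.1.2.symm ▸ hm)).elim
  have hr := D.measurable_family_level (3 * n + 1)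
  have hr' := D.measurable_family_level (3 * n + 2)
  have hind := hD.indep_level (r := 3 * n + 1) (a := .val n) (by simp [Source.rank])
  have hvm : MeasurableSet[MeasurableSpace.comap (D.family (.val n)) inferInstance]
      {ω | Joins p C.card (D.val n ω)} := ⟨_, measurableSet_joins p C.card, rfl⟩
  have hEm := fun r (hn : 3 * n + 1 ≤ r) =>
    (@measurableSet_history _ _ (D.level r) D p _ (D.measurable_family_level r) (n + 1)
      (by omega) A).inter
    (@measurableSet_busy_eq _ _ (D.level r) D p _ (D.measurable_family_level r) n hn C)
  have hem : ∀ j ∈ C, Measurable[D.level (3 * n + 1)] (D.residual (n + 1) j) := fun j hj =>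
    measurable_residual_succ hr le_rfl fun m hm => hC m (hm ▸ hj)
  by_cases hq : q
  · by_cases hB : B = insert (Sum.inr n) C
    · subst hB
      have hnC : Sum.inr n ∉ C := fun h => lt_irrefl _ (hC n h)
      have h1 := ((hD.residualLaw_busy_history p hmu h C).inter_indep
        (m := D.level (3 * n + 1)) (hEm _ le_rfl) hem hind hvm)
      -- The valuation already enters the event, hence `3 * n + 2`; the new job's residual time is
      -- its service time, of rank `3 * n + 3`.
      have h2 := h1.insert_indep (m := D.level (3 * n + 2)) (n := Sum.inr n) ?_ hnC ?_ ?_ ?_ ?_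
      · refine h2.congr_set (Eventually.of_forall fun ω => ?_)
        simp only [Set.mem_inter_iff, Set.mem_ofPred_eq, hq, eq_iff_iff, iff_true]
        constructor
        · rintro ⟨⟨⟨h3, -⟩, h4⟩, h5⟩
          refine ⟨⟨h3, h4⟩, ?_⟩
          rwa [← h4, card_busy]
        · rintro ⟨⟨h3, h4⟩, h5⟩
          rw [← h4, card_busy] at h5
          refine ⟨⟨⟨h3, ?_⟩, h4⟩, h5⟩
          rw [present, if_pos h5, h4]
      · refine MeasurableSet.inter (hEm _ (by omega)) ?_
        exact hr' (.val n) (by simp [Source.rank]) (measurableSet_joins p C.card)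
      · exact fun j hj => measurable_residual_succ hr' (by omega) fun m hm => hC m (hm ▸ hj)
      · rw [residual_succ_inr]
        exact hD.indep_level (a := .serv n) (by simp [Source.rank])
      · rw [residual_succ_inr]; exact hD.serv_law n
      · rw [residual_succ_inr]; exact hD.measurable (.serv n)
    · refine residualLaw_of_measure_zero
        (measure_mono_null (t := ∅) (fun ω hω => ?_) measure_empty)
      obtain ⟨⟨⟨-, h1⟩, h2⟩, h3⟩ := hω
      simp only [Set.mem_ofPred_eq, hq, eq_iff_iff, iff_true] at h1 h2 h3
      rw [present, if_pos h3, h2] at h1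
      exact hB h1.symm
  · by_cases hB : B = C
    · subst hB
      have h1 := ((hD.residualLaw_busy_history p hmu h B).inter_indep
        (m := D.level (3 * n + 1)) (hEm _ le_rfl) hem hind hvm.compl)
      refine h1.congr_set (Eventually.of_forall fun ω => ?_)
      simp only [Set.mem_inter_iff, Set.mem_ofPred_eq, hq, eq_iff_iff, iff_false,
        Set.mem_compl_iff]
      constructor
      · rintro ⟨⟨⟨h3, -⟩, h4⟩, h5⟩
        refine ⟨⟨h3, h4⟩, ?_⟩
        rwa [← h4, card_busy]
      · rintro ⟨⟨h3, h4⟩, h5⟩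
        rw [← h4, card_busy] at h5
        refine ⟨⟨⟨h3, ?_⟩, h4⟩, h5⟩
        rw [present, if_neg h5, h4]
    · refine residualLaw_of_measure_zero
        (measure_mono_null (t := ∅) (fun ω hω => ?_) measure_empty)
      obtain ⟨⟨⟨-, h1⟩, h2⟩, h3⟩ := hω
      simp only [Set.mem_ofPred_eq, hq, eq_iff_iff, iff_false] at h1 h2 h3
      rw [present, if_neg h3, h2] at h1
      exact hB h1.symm

/-- Given the states seen so far and the set of the jobs in service, the residual times are
independent and exponential. -/
theorem IsModel.residualLaw_present (hD : D.IsModel P lam mu F G) (hmu : 0 < mu)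
    (A : ℕ → Set ℕ) (n : ℕ) (B : Finset (Fin K ⊕ ℕ)) :
    ResidualLaw P (D.history p A n ∩ {ω | D.present p n ω = B}) B (D.residual n)
      (expMeasure mu) := by
  induction n generalizing B with
  | zero => simpa [history] using hD.residualLaw_zero p B
  | succ n ih => exact hD.residualLaw_present_succ p hmu ih B

theorem IsModel.isProbabilityMeasure_inter (hD : D.IsModel P lam mu F G) :
    IsProbabilityMeasure F :=
  hD.inter_law 0 ▸ Measure.isProbabilityMeasure_map (hD.measurable (.inter 0)).aemeasurable

theorem IsModel.isProbabilityMeasure_val (hD : D.IsModel P lam mu F G) :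
    IsProbabilityMeasure G :=
  hD.val_law 0 ▸ Measure.isProbabilityMeasure_map (hD.measurable (.val 0)).aemeasurable

/-- Continuity of the distribution function excludes an atom at `x`, so the weak inequality in the
joining rule costs nothing. -/
theorem IsModel.measure_le_val (hD : D.IsModel P lam mu F G) (n : ℕ) (x : ℝ) :
    P {ω | x ≤ D.val n ω} = ENNReal.ofReal (tail G x) := by
  have := hD.isProbabilityMeasure_val
  have h1 : P {ω | x ≤ D.val n ω} = G (Set.Ici x) := by
    rw [← hD.val_law n]
    exact (Measure.map_apply (hD.measurable (.val n)) measurableSet_Ici).symm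
  have h2 : G {x} = 0 := by
    rw [← measure_cdf G, StieltjesFunction.measure_singleton,
      hD.val_continuous.continuousAt.continuousWithinAt.leftLim_eq, sub_self, ENNReal.ofReal_zero]
  rw [h1, ← Set.Ioi_union_left, measure_union (by simp) (measurableSet_singleton x), h2, add_zero,
    ← Set.compl_Iic, prob_compl_eq_one_sub measurableSet_Iic, ← ofReal_cdf, tail,
    ENNReal.ofReal_sub _ (cdf_nonneg G x), ENNReal.ofReal_one]

theorem IsModel.measure_joins (hD : D.IsModel P lam mu F G) (n : ℕ) (k : Fin (K + 1)) :
    P {ω | Joins p k (D.val n ω)} = ENNReal.ofReal (joinProb G p k) := by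
  by_cases h : (k : ℕ) < K
  · simp only [Joins, h, exists_true_left, joinProb, dif_pos]
    exact hD.measure_le_val n _
  · simp [Joins, h, joinProb]

/-- Only the last constraint is required to be a singleton. Singletons throughout give the Markov
property; no constraint on earlier states gives the recursion for `stateLaw`. -/
theorem IsModel.measure_history_inter_seen (hD : D.IsModel P lam mu F G) (hmu : 0 < mu)
    {A : ℕ → Set ℕ} {n : ℕ} {k : Fin (K + 1)} (hA : A n = {(k : ℕ)}) (j : Fin (K + 1)) :
    P (D.history p A (n + 1) ∩ {ω | D.seen p (n + 1) ω = j})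
      = P (D.history p A (n + 1)) * ENNReal.ofReal (transition mu F G p k j) := by
  classical
  have := hD.isProbabilityMeasure_inter
  have hX := measurableSet_present_eq p (hD.measurable_of_rank (3 * (n + 1))) (n := n + 1) le_rfl
  have hs := fun i => survivalProb_nonneg (F := F) hmu hD.inter_nonneg i j
  set H := D.history p A (n + 1) with hH
  set J : Set Ω := {ω | Joins p k (D.val n ω)} with hJ
  have hJm : MeasurableSet J := (measurableSet_joins p k).preimage (hD.measurable (.val n))
  have hHm : MeasurableSet[D.level (3 * n + 1)] H :=
    @measurableSet_history _ _ (D.level (3 * n + 1)) _ p _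
      (D.measurable_family_level (3 * n + 1)) (n + 1) (by omega) A
  have hind := hD.indep_level (r := 3 * n + 1) (a := .val n) (by simp [Source.rank])
  have hJm' : MeasurableSet[MeasurableSpace.comap (D.family (.val n)) inferInstance] J :=
    ⟨_, measurableSet_joins p k, rfl⟩
  have hP1 : P (H ∩ J) = P H * ENNReal.ofReal (joinProb G p k) := by
    rw [(Indep_iff _ _ _).1 hind _ _ hHm hJm', hD.measure_joins]
  have hP2 : P (H ∩ Jᶜ) = P H * ENNReal.ofReal (1 - joinProb G p k) := by
    rw [(Indep_iff _ _ _).1 hind _ _ hHm hJm'.compl, prob_compl_eq_one_sub hJm, hD.measure_joins,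
      ENNReal.ofReal_sub _ (joinProb_mem_Icc p G k).1, ENNReal.ofReal_one]
  have hcard : ∀ ω ∈ H, (D.present p (n + 1) ω).card = if ω ∈ J then (k : ℕ) + 1 else k := by
    intro ω hω
    have hk : D.seen p n ω = k := by
      have := hω n (Nat.lt_succ_self n)
      rwa [hA] at this
    rw [card_present_succ, hk]
    rfl
  -- For each set of jobs after arrival `n`, the number surviving is mixed binomial. That set has `k
  -- + 1` elements if the customer joins and `k` otherwise; summation over `B` then leaves only the
  -- joining probability.
  have hstep : ∀ B, P (H ∩ {ω | D.seen p (n + 1) ω = j} ∩ {ω | D.present p (n + 1) ω = B})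
      = P (H ∩ J ∩ {ω | D.present p (n + 1) ω = B}) * ENNReal.ofReal (survivalProb mu F (k + 1) j)
        + P (H ∩ Jᶜ ∩ {ω | D.present p (n + 1) ω = B}) * ENNReal.ofReal (survivalProb mu F k j) := by
    intro B
    by_cases hB : ∀ m, Sum.inr m ∈ B → m < n + 1
    swap
    · have : {ω | D.present p (n + 1) ω = B} = ∅ := Set.eq_empty_of_forall_notMem fun ω hω =>
        hB fun m hm => D.lt_of_inr_mem_present p (hω.symm ▸ hm)
      simp [this]
    have hr := D.measurable_family_level (3 * (n + 1))
    have h1 := (hD.residualLaw_present p hmu A (n + 1) B).measure_card_survivors hmu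
      (hD.level_le (3 * (n + 1)))
      ((@measurableSet_history _ _ (D.level (3 * (n + 1))) _ p _ hr (n + 1) (by omega) A).inter
        (@measurableSet_present_eq _ _ (D.level (3 * (n + 1))) _ p _ hr (n + 1) le_rfl B))
      (fun j hj => measurable_residual hr le_rfl fun m hm => hB m (hm ▸ hj))
      (hD.measurable (.inter (n + 1)))
      (hD.indep_level (a := .inter (n + 1)) (by simp [Source.rank]))
      (hD.inter_nonneg_ae.mono fun ω hω => hω (n + 1)) j
    have hlaw : P.map (D.family (.inter (n + 1))) = F := hD.inter_law (n + 1)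
    rw [hlaw] at h1
    have h2 : P (H ∩ {ω | D.seen p (n + 1) ω = j} ∩ {ω | D.present p (n + 1) ω = B})
        = P (H ∩ {ω | D.present p (n + 1) ω = B})
          * ENNReal.ofReal (survivalProb mu F B.card j) := by
      rw [← h1]
      refine measure_congr ?_
      filter_upwards [hD.inter_nonneg_ae] with ω hω
      refine propext ?_
      change ((ω ∈ H ∧ D.seen p (n + 1) ω = j) ∧ D.present p (n + 1) ω = B) ↔
        ((ω ∈ H ∧ D.present p (n + 1) ω = B) ∧
          (B.filter fun i => D.inter (n + 1) ω ≤ D.residual (n + 1) i ω).card = j)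
      rw [← D.card_busy p (n + 1) ω, D.busy_eq_filter_present p hω (n + 1)]
      constructor
      · rintro ⟨⟨h2, h3⟩, h4⟩
        subst h4
        exact ⟨⟨h2, rfl⟩, h3⟩
      · rintro ⟨⟨h2, h4⟩, h3⟩
        subst h4
        exact ⟨⟨h2, h3⟩, rfl⟩
    have h3 : P (H ∩ {ω | D.present p (n + 1) ω = B})
        = P (H ∩ J ∩ {ω | D.present p (n + 1) ω = B})
          + P (H ∩ Jᶜ ∩ {ω | D.present p (n + 1) ω = B}) := by
      rw [← measure_inter_add_sdiff _ hJm, Set.inter_right_comm, Set.sdiff_eq,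
        Set.inter_right_comm H _ Jᶜ]
    rw [h2, h3, add_mul]
    congr 1
    · by_cases h0 : (H ∩ J ∩ {ω | D.present p (n + 1) ω = B}).Nonempty
      · obtain ⟨ω, ⟨h4, h5⟩, h6⟩ := h0
        have := hcard ω h4
        rw [if_pos h5, show D.present p (n + 1) ω = B from h6] at this
        rw [this]
      · rw [Set.not_nonempty_iff_eq_empty.1 h0]; simp
    · by_cases h0 : (H ∩ Jᶜ ∩ {ω | D.present p (n + 1) ω = B}).Nonempty
      · obtain ⟨ω, ⟨h4, h5⟩, h6⟩ := h0
        have := hcard ω h4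
        rw [if_neg h5, show D.present p (n + 1) ω = B from h6] at this
        rw [this]
      · rw [Set.not_nonempty_iff_eq_empty.1 h0]; simp
  rw [measure_eq_tsum_fibers hX, tsum_congr hstep, ENNReal.tsum_add, ENNReal.tsum_mul_right,
    ENNReal.tsum_mul_right, ← measure_eq_tsum_fibers hX, ← measure_eq_tsum_fibers hX, hP1, hP2,
    mul_assoc, mul_assoc, ← mul_add]
  have hj := joinProb_mem_Icc p G k
  rw [← ENNReal.ofReal_mul hj.1, ← ENNReal.ofReal_mul (by linarith [hj.2]),
    ← ENNReal.ofReal_add (mul_nonneg hj.1 (hs _)) (mul_nonneg (by linarith [hj.2]) (hs _))]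
  rfl

theorem IsModel.isMarkovChain_seen (hD : D.IsModel P lam mu F G) (hmu : 0 < mu) :
    IsMarkovChain P (D.seen p) (transition mu F G p) := by
  have := hD.isProbabilityMeasure_inter
  refine ⟨hD.measurable_seen p, hD.seen_le_ae p, transition_nonneg p hmu hD.inter_nonneg,
    sum_transition p hmu hD.inter_nonneg, fun n z => ?_⟩
  have h := hD.measure_history_inter_seen p hmu (A := fun i => {(z i : ℕ)}) (n := n) rfl
    (z (n + 1))
  have h1 : {ω | ∀ i ≤ n + 1, D.seen p i ω = (z i : ℕ)}
      = D.history p (fun i => {(z i : ℕ)}) (n + 1) ∩ {ω | D.seen p (n + 1) ω = z (n + 1)} := by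
    ext ω
    constructor
    · intro h
      exact ⟨fun i hi => h i hi.le, h (n + 1) le_rfl⟩
    · rintro ⟨h, h'⟩ i hi
      rcases hi.lt_or_eq with hi | rfl
      · exact h i hi
      · exact h'
  have h2 : {ω | ∀ i ≤ n, D.seen p i ω = (z i : ℕ)}
      = D.history p (fun i => {(z i : ℕ)}) (n + 1) := by
    ext ω
    exact ⟨fun h i hi => h i (Nat.lt_succ_iff.1 hi), fun h i hi => h i (Nat.lt_succ_iff.2 hi)⟩
  rw [h1, h2, measureReal_def, h, ENNReal.toReal_mul,
    ENNReal.toReal_ofReal (transition_nonneg p hmu hD.inter_nonneg _ _), measureReal_def]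

/-- The law of the state seen by customer `n`. -/
noncomputable def stateLaw (D : Primitives Ω K) (P : Measure Ω) (n : ℕ) (k : Fin (K + 1)) : ℝ :=
  P.real {ω | D.seen p n ω = k}

theorem IsModel.measureReal_eq_sum_seen (hD : D.IsModel P lam mu F G) (n : ℕ) (A : Set Ω) :
    P.real A = ∑ k : Fin (K + 1), P.real ({ω | D.seen p n ω = k} ∩ A) := by
  have hm : ∀ k : ℕ, MeasurableSet {ω | D.seen p n ω = k} := fun k =>
    measurableSet_eq_fun (hD.measurable_seen p n) measurable_const
  have h1 : P A = ∑ k : Fin (K + 1), P ({ω | D.seen p n ω = k} ∩ A) := by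
    rw [measure_eq_tsum_fibers hm, tsum_eq_sum (s := Finset.range (K + 1)),
      Fin.sum_univ_eq_sum_range (fun k => P ({ω | D.seen p n ω = k} ∩ A))]
    · simp only [Set.inter_comm]
    · intro k hk
      refine measure_mono_null Set.inter_subset_right (measure_eq_zero_iff_ae_notMem.2 ?_)
      filter_upwards [hD.seen_le_ae p] with ω hω h
      have := hω n
      rw [show D.seen p n ω = k from h] at this
      exact hk (Finset.mem_range.2 (by omega))
  simp only [measureReal_def]
  rw [h1, ENNReal.toReal_sum fun _ _ => measure_ne_top _ _]

theorem IsModel.stateLaw_succ (hD : D.IsModel P lam mu F G) (hmu : 0 < mu) (n : ℕ) :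
    D.stateLaw p P (n + 1) = Matrix.vecMul (D.stateLaw p P n) (transition mu F G p) := by
  have := hD.isProbabilityMeasure_inter
  funext j
  rw [stateLaw, hD.measureReal_eq_sum_seen p n]
  refine Finset.sum_congr rfl fun k _ => ?_
  have h := hD.measure_history_inter_seen p hmu (k := k)
    (A := fun i => if i = n then {(k : ℕ)} else Set.univ) (n := n) (by simp) j
  have h1 : D.history p (fun i => if i = n then {(k : ℕ)} else Set.univ) (n + 1)
      = {ω | D.seen p n ω = k} := by
    ext ω
    simp only [history, Set.mem_ofPred_eq]
    constructor
    · intro h; simpa using h n n.lt_succ_self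
    · intro h i _
      by_cases hi : i = n
      · subst hi; simpa using h
      · simp [hi]
  rw [h1] at h
  rw [measureReal_def, h, ENNReal.toReal_mul,
    ENNReal.toReal_ofReal (transition_nonneg p hmu hD.inter_nonneg _ _)]
  rfl

theorem IsModel.sum_stateLaw (hD : D.IsModel P lam mu F G) (n : ℕ) :
    ∑ k, D.stateLaw p P n k = 1 := by
  have := hD.measureReal_eq_sum_seen p n Set.univ
  simpa [stateLaw] using this.symm

theorem IsModel.tendsto_stateLaw (hD : D.IsModel P lam mu F G) (hlam : 0 < lam) (hmu : 0 < mu)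
    {π : Fin (K + 1) → ℝ} (hπ : IsStationary (transition mu F G p) π) (k : Fin (K + 1)) :
    Tendsto (fun n => D.stateLaw p P n k) atTop (𝓝 (π k)) := by
  have := hD.isProbabilityMeasure_inter
  obtain ⟨ε, hε, h⟩ := exists_doeblin_transition (G := G) p hmu hD.inter_nonneg
    (by rw [hD.inter_mean]; positivity)
  exact tendsto_law_of_stationary (transition_nonneg p hmu hD.inter_nonneg)
    (sum_transition p hmu hD.inter_nonneg) hε h (hD.stateLaw_succ p hmu) hπ.2
    (by rw [hD.sum_stateLaw, hπ.1.2]) k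

theorem IsModel.existsUnique_isStationary (hD : D.IsModel P lam mu F G) (hlam : 0 < lam)
    (hmu : 0 < mu) : ∃! π, IsStationary (transition mu F G p) π := by
  have := hD.isProbabilityMeasure_inter
  obtain ⟨ε, hε, h⟩ := exists_doeblin_transition (G := G) p hmu hD.inter_nonneg
    (by rw [hD.inter_mean]; positivity)
  exact existsUnique_stationary_of_doeblin (transition_nonneg p hmu hD.inter_nonneg)
    (sum_transition p hmu hD.inter_nonneg) hε h

end Primitives

/-! ### Renewal theory for the arrival count. -/

namespace Primitives

variable {Ω : Type*} {K : ℕ} {D : Primitives Ω K}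

section Pathwise

variable {ω : Ω}

theorem monotone_arrival (h0 : ∀ n, 0 ≤ D.inter n ω) : Monotone fun n => D.arrival n ω :=
  monotone_nat_of_le_succ fun n => by
    rw [arrival_eq_prior_succ, arrival_eq_prior_succ, prior_succ D (n + 1)]
    linarith [h0 (n + 1)]

theorem tendsto_prior_atTop {a : ℝ} (ha : 0 < a)
    (h : Tendsto (fun n : ℕ => D.prior n ω / n) atTop (𝓝 a)) :
    Tendsto (fun n => D.prior n ω) atTop atTop := by
  refine (h.pos_mul_atTop ha tendsto_natCast_atTop_atTop).congr' ?_
  filter_upwards [eventually_ne_atTop 0] with n hn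
  exact div_mul_cancel₀ _ (by exact_mod_cast hn)

/-- Divergence of the arrival instants makes the counted set finite, so `ncard` does not take its
default value `0`; monotonicity makes the set an initial segment. -/
theorem lt_count_iff (h0 : ∀ n, 0 ≤ D.inter n ω)
    (h : Tendsto (fun n => D.prior n ω) atTop atTop) {t : ℝ} {n : ℕ} :
    n < D.count t ω ↔ D.arrival n ω ≤ t := by
  classical
  have hex : ∃ m, t < D.arrival m ω :=
    (((tendsto_add_atTop_iff_nat 1).2 h).eventually_gt_atTop t).exists
  have hset : {n | D.arrival n ω ≤ t} = (Finset.range (Nat.find hex) : Set ℕ) := by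
    ext m
    simp only [Set.mem_ofPred_eq, Finset.coe_range, Set.mem_Iio, Nat.lt_find_iff, not_lt]
    exact ⟨fun h m' hm' => (monotone_arrival h0 hm').trans h, fun h => h m le_rfl⟩
  have hc : D.count t ω = Nat.find hex := by
    rw [count, hset, Set.ncard_coe_finset, Finset.card_range]
  have : n ∈ {n | D.arrival n ω ≤ t} ↔ n < D.count t ω := by
    rw [hset, hc]; simp
  exact this.symm

/-- With `N` arrivals by time `t`, one has `prior N ≤ t < prior (N + 1)`; dividing by `N` squeezes
`t / N`. -/
theorem tendsto_count_div (h0 : ∀ n, 0 ≤ D.inter n ω) {a : ℝ} (ha : 0 < a)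
    (h : Tendsto (fun n : ℕ => D.prior n ω / n) atTop (𝓝 a)) :
    Tendsto (fun t : ℝ => (D.count t ω : ℝ) / t) atTop (𝓝 a⁻¹) := by
  have hlt := fun t n => lt_count_iff (t := t) (n := n) h0 (tendsto_prior_atTop ha h)
  have hN : Tendsto (fun t : ℝ => D.count t ω) atTop atTop := by
    refine tendsto_atTop.2 fun b => ?_
    filter_upwards [eventually_ge_atTop (D.arrival b ω)] with t ht
    exact ((hlt t b).2 ht).le
  have hlow := h.comp hN
  have hratio : Tendsto (fun n : ℕ => ((n : ℝ) + 1) / n) atTop (𝓝 1) := by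
    have h1 : Tendsto (fun n : ℕ => 1 + 1 / (n : ℝ)) atTop (𝓝 (1 + 0)) :=
      tendsto_const_nhds.add tendsto_one_div_atTop_nhds_zero_nat
    rw [add_zero] at h1
    refine h1.congr' ?_
    filter_upwards [eventually_ne_atTop 0] with n hn
    have : (n : ℝ) ≠ 0 := by exact_mod_cast hn
    field_simp
  have hup := (((tendsto_add_atTop_iff_nat 1).2 h).mul hratio).comp hN
  rw [mul_one] at hup
  have hmid : Tendsto (fun t : ℝ => t / (D.count t ω : ℝ)) atTop (𝓝 a) := by
    refine tendsto_of_tendsto_of_tendsto_of_le_of_le' hlow hup ?_ ?_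
    · filter_upwards [eventually_ge_atTop 0] with t ht
      refine div_le_div_of_nonneg_right ?_ (Nat.cast_nonneg _)
      change D.prior (D.count t ω) ω ≤ t
      rcases Nat.eq_zero_or_eq_succ_pred (D.count t ω) with h1 | h1
      · rw [h1]; simpa [prior] using ht
      · rw [h1, Nat.succ_eq_add_one, ← arrival_eq_prior_succ]
        exact (hlt t _).1 (by omega)
    · filter_upwards [hN.eventually_gt_atTop 0] with t ht
      have h1 : t < D.prior (D.count t ω + 1) ω := by
        by_contra! h2
        exact lt_irrefl _ ((hlt t _).2 h2)
      have h2 : (0 : ℝ) < D.count t ω := by exact_mod_cast ht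
      simp only [Function.comp_apply, Nat.cast_add, Nat.cast_one]
      rw [div_mul_div_cancel₀ (by positivity)]
      exact div_le_div_of_nonneg_right h1.le h2.le
  simpa using hmid.inv₀ ha.ne'

/-- The sum that bounds the number of arrivals up to a linear function. -/
noncomputable def excess (D : Primitives Ω K) (c : ℝ) (ω : Ω) : ℝ≥0∞ :=
  ∑' n : ℕ, ENNReal.ofReal (Real.exp (((n : ℝ) + 1) * c - D.arrival n ω))

theorem count_le (h0 : ∀ n, 0 ≤ D.inter n ω)
    (h : Tendsto (fun n => D.prior n ω) atTop atTop) {c : ℝ} (hc : 0 < c)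
    (hW : D.excess c ω ≠ ∞) (t : ℝ) :
    (D.count t ω : ℝ) ≤ |t| / c + 1 + (D.excess c ω).toReal := by
  set M := ⌈|t| / c⌉₊ with hM
  have h1 : (D.count t ω : ℝ≥0∞) ≤ M + D.excess c ω := by
    have h2 : ((D.count t ω - M : ℕ) : ℝ≥0∞) ≤ D.excess c ω := by
      -- A counted customer with `n ≥ |t| / c` arrived by `t ≤ n * c`, so its term in `excess` is at
      -- least `1`.
      refine le_trans ?_ (ENNReal.sum_le_tsum (Finset.Ico M (D.count t ω)))
      rw [← Nat.card_Ico, Finset.cast_card]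
      refine Finset.sum_le_sum fun n hn => ?_
      rw [Finset.mem_Ico] at hn
      rw [← ENNReal.ofReal_one]
      refine ENNReal.ofReal_le_ofReal (Real.one_le_exp ?_)
      have h3 := (lt_count_iff h0 h).1 hn.2
      have h4 : |t| / c ≤ n := (Nat.le_ceil _).trans (by exact_mod_cast hn.1)
      rw [div_le_iff₀ hc] at h4
      nlinarith [le_abs_self t]
    calc (D.count t ω : ℝ≥0∞) ≤ ((M + (D.count t ω - M) : ℕ) : ℝ≥0∞) := by
          exact_mod_cast (by omega)
      _ ≤ M + D.excess c ω := by push_cast; gcongr; exact_mod_cast h2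
  have h5 := ENNReal.toReal_mono (ENNReal.add_ne_top.2 ⟨ENNReal.natCast_ne_top M, hW⟩) h1
  rw [ENNReal.toReal_add (ENNReal.natCast_ne_top M) hW, ENNReal.toReal_natCast,
    ENNReal.toReal_natCast] at h5
  have h6 := (Nat.ceil_lt_add_one (a := |t| / c) (by positivity)).le
  linarith

end Pathwise

variable [mΩ : MeasurableSpace Ω] {P : Measure Ω} {lam mu : ℝ} {F G : Measure ℝ}

theorem IsModel.measurable_arrival (hD : D.IsModel P lam mu F G) (n : ℕ) :
    Measurable (D.arrival n) :=
  measurable_prior (hD.measurable_of_rank (3 * n + 1)) (n := n + 1) (by omega)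

theorem IsModel.tendsto_prior_div (hD : D.IsModel P lam mu F G) :
    ∀ᵐ ω ∂P, Tendsto (fun n : ℕ => D.prior n ω / n) atTop (𝓝 (1 / lam)) := by
  have hm := fun n => hD.measurable (.inter n)
  have hint : Integrable (D.inter 0) P := by
    have h := hD.inter_integrable
    rw [← hD.inter_law 0] at h
    exact (integrable_map_measure aestronglyMeasurable_id (hm 0).aemeasurable).1 h
  have hmean : ∫ ω, D.inter 0 ω ∂P = 1 / lam := by
    rw [← hD.inter_mean, ← hD.inter_law 0]
    exact (integral_map (hm 0).aemeasurable aestronglyMeasurable_id).symm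
  rw [← hmean]
  refine strong_law_ae_real D.inter hint (fun i j hij => ?_) fun i => ?_
  · exact hD.indep.indepFun (i := .inter i) (j := .inter j) (by simpa using hij)
  · exact ⟨(hm i).aemeasurable, (hm 0).aemeasurable, by rw [hD.inter_law, hD.inter_law]⟩

theorem IsModel.lt_count_iff_ae (hD : D.IsModel P lam mu F G) (hlam : 0 < lam) :
    ∀ᵐ ω ∂P, ∀ t n, n < D.count t ω ↔ D.arrival n ω ≤ t := by
  filter_upwards [hD.inter_nonneg_ae, hD.tendsto_prior_div] with ω h0 h
  exact fun t n => lt_count_iff h0 (tendsto_prior_atTop (by positivity) h)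

/-- Almost surely the random range can be replaced by indicators of `arrival n ≤ t`, whose partial
sums are measurable and eventually constant. -/
theorem IsModel.aestronglyMeasurable_sum_count (hD : D.IsModel P lam mu F G) (hlam : 0 < lam)
    {g : ℕ → Ω → ℝ} (hg : ∀ n, Measurable (g n)) (t : ℝ) :
    AEStronglyMeasurable (fun ω => ∑ n ∈ Finset.range (D.count t ω), g n ω) P := by
  refine aestronglyMeasurable_of_tendsto_ae atTop
    (f := fun N ω => ∑ n ∈ Finset.range N, {ω | D.arrival n ω ≤ t}.indicator (g n) ω)
    (fun N => ?_) ?_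
  · exact (Finset.measurable_fun_sum _ fun n _ => (hg n).indicator
      (measurableSet_le (hD.measurable_arrival n) measurable_const)).aestronglyMeasurable
  · filter_upwards [hD.lt_count_iff_ae hlam] with ω hω
    refine tendsto_const_nhds.congr' ?_
    filter_upwards [eventually_ge_atTop (D.count t ω)] with N hN
    rw [← Finset.sum_subset (Finset.range_mono hN)]
    · refine Finset.sum_congr rfl fun n hn => ?_
      rw [Set.indicator_of_mem]
      exact (hω t n).1 (Finset.mem_range.1 hn)
    · intro n _ hn
      rw [Set.indicator_of_notMem]
      exact fun h => hn (Finset.mem_range.2 ((hω t n).2 h))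

variable [IsProbabilityMeasure P]

theorem IsModel.integral_exp_neg_lt_one (hD : D.IsModel P lam mu F G) (hlam : 0 < lam) :
    ∫ x, Real.exp (-x) ∂F < 1 := by
  have := hD.isProbabilityMeasure_inter
  have h := survivalProb_zero_pos (mu := 1) one_pos hD.inter_nonneg
    (by rw [hD.inter_mean]; positivity) 1
  have hi : Integrable (fun x => Real.exp (-x)) F := by
    have := integrable_survival (mu := 1) one_pos hD.inter_nonneg 1 1
    simpa using this
  have h2 : survivalProb 1 F 1 0 = 1 - ∫ x, Real.exp (-x) ∂F := by
    rw [survivalProb]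
    simp only [Nat.choose_zero_right, Nat.cast_one, pow_zero, mul_one, one_mul, neg_mul,
      Nat.sub_zero, pow_one]
    rw [integral_sub (integrable_const _) hi]
    simp
  linarith

theorem IsModel.lintegral_exp_arrival (hD : D.IsModel P lam mu F G) (c : ℝ) (n : ℕ) :
    ∫⁻ ω, ENNReal.ofReal (Real.exp (((n : ℝ) + 1) * c - D.arrival n ω)) ∂P
      = ENNReal.ofReal (Real.exp c * ∫ x, Real.exp (-x) ∂F) ^ (n + 1) := by
  have hm : ∀ n, Measurable (D.inter n) := fun n => hD.measurable (.inter n)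
  have hind : iIndepFun D.inter P :=
    hD.indep.precomp (g := Source.inter) fun i j h => Source.inter.inj h
  have hmgf : ∀ i, mgf (D.inter i) P (-1) = ∫ x, Real.exp (-x) ∂F := by
    intro i
    rw [mgf, ← hD.inter_law i, integral_map (hm i).aemeasurable (by fun_prop)]
    simp
  have h1 : ∫ ω, Real.exp (-D.arrival n ω) ∂P = (∫ x, Real.exp (-x) ∂F) ^ (n + 1) := by
    have h := hind.mgf_sum (t := -1) hm (Finset.range (n + 1))
    simp only [hmgf, Finset.prod_const, Finset.card_range] at h
    rw [← h, mgf]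
    simp [arrival]
  have hbd : Integrable (fun ω => Real.exp (-D.arrival n ω)) P := by
    refine Integrable.of_bound (C := 1)
      (hD.measurable_arrival n).neg.exp.aestronglyMeasurable ?_
    filter_upwards [hD.inter_nonneg_ae] with ω hω
    rw [Real.norm_of_nonneg (Real.exp_nonneg _), Real.exp_le_one_iff, neg_nonpos]
    exact Finset.sum_nonneg fun i _ => hω i
  have h2 : ∀ ω, Real.exp (((n : ℝ) + 1) * c - D.arrival n ω)
      = Real.exp c ^ (n + 1) * Real.exp (-D.arrival n ω) := by
    intro ω
    rw [← Real.exp_nat_mul, ← Real.exp_add]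
    push_cast
    ring_nf
  simp only [h2]
  rw [← ofReal_integral_eq_lintegral_ofReal (hbd.const_mul _)
    (Eventually.of_forall fun ω => by positivity), integral_const_mul, h1, ← mul_pow,
    ENNReal.ofReal_pow (mul_nonneg (Real.exp_nonneg _)
      (integral_nonneg fun x => Real.exp_nonneg _))]

theorem IsModel.exists_lintegral_excess_ne_top (hD : D.IsModel P lam mu F G) (hlam : 0 < lam) :
    ∃ c > 0, ∫⁻ ω, D.excess c ω ∂P ≠ ∞ := by
  set φ := ∫ x, Real.exp (-x) ∂F with hφ
  -- As `φ < 1`, a small positive `c` keeps the ratio of the geometric series for the mean of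
  -- `excess` below `1`.
  have h1 : ∀ᶠ c in 𝓝[>] (0 : ℝ), Real.exp c * φ < 1 := by
    have hcont : Continuous fun c : ℝ => Real.exp c * φ := by fun_prop
    refine (hcont.tendsto 0).mono_left nhdsWithin_le_nhds |>.eventually_lt_const ?_
    simpa using hD.integral_exp_neg_lt_one hlam
  obtain ⟨c, hc, hc0⟩ := (h1.and self_mem_nhdsWithin).exists
  refine ⟨c, hc0, ?_⟩
  have h2 : ENNReal.ofReal (Real.exp c * φ) < 1 := by
    rw [← ENNReal.ofReal_one]; exact (ENNReal.ofReal_lt_ofReal_iff one_pos).2 hc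
  have hm : ∀ n : ℕ, Measurable fun ω =>
      ENNReal.ofReal (Real.exp (((n : ℝ) + 1) * c - D.arrival n ω)) := fun n =>
    (measurable_const.sub (hD.measurable_arrival n)).exp.ennreal_ofReal
  unfold excess
  rw [lintegral_tsum fun n => (hm n).aemeasurable]
  simp only [hD.lintegral_exp_arrival c, ← hφ, pow_succ']
  rw [ENNReal.tsum_mul_left, ENNReal.tsum_geometric]
  exact ENNReal.mul_ne_top ENNReal.ofReal_ne_top
    (ENNReal.inv_ne_top.2 (tsub_pos_of_lt h2).ne')

/-- An integrable bound for the number of arrivals. -/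
theorem IsModel.exists_count_le (hD : D.IsModel P lam mu F G) (hlam : 0 < lam) :
    ∃ c > 0, ∃ W : Ω → ℝ, Integrable W P ∧
      ∀ᵐ ω ∂P, ∀ t, (D.count t ω : ℝ) ≤ |t| / c + 1 + W ω := by
  obtain ⟨c, hc, hW⟩ := hD.exists_lintegral_excess_ne_top hlam
  have hm : Measurable (D.excess c) := by
    unfold excess
    exact Measurable.tsum fun n =>
      (measurable_const.sub (hD.measurable_arrival n)).exp.ennreal_ofReal
  refine ⟨c, hc, fun ω => (D.excess c ω).toReal,
    integrable_toReal_of_lintegral_ne_top hm.aemeasurable hW, ?_⟩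
  filter_upwards [hD.inter_nonneg_ae, hD.tendsto_prior_div, ae_lt_top hm hW] with ω h0 h hω
  exact count_le h0 (tendsto_prior_atTop (by positivity) h) hc hω.ne

theorem IsModel.integrable_count (hD : D.IsModel P lam mu F G) (hlam : 0 < lam) (t : ℝ) :
    Integrable (fun ω => (D.count t ω : ℝ)) P := by
  obtain ⟨c, hc, W, hW, hle⟩ := hD.exists_count_le hlam
  refine Integrable.mono' ((integrable_const (|t| / c + 1)).add hW) ?_ ?_
  · simpa using hD.aestronglyMeasurable_sum_count hlam (g := fun _ _ => 1)
      (fun _ => measurable_const) t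
  · filter_upwards [hle] with ω hω
    rw [Real.norm_of_nonneg (Nat.cast_nonneg _)]
    exact hω t

/-- The elementary renewal theorem in mean. -/
theorem IsModel.tendsto_integral_abs_count_sub (hD : D.IsModel P lam mu F G) (hlam : 0 < lam) :
    Tendsto (fun t : ℝ => (∫ ω, |(D.count t ω : ℝ) - ⌊lam * t⌋₊| ∂P) / t) atTop (𝓝 0) := by
  obtain ⟨c, hc, W, hW, hle⟩ := hD.exists_count_le hlam
  have key : Tendsto (fun t : ℝ => ∫ ω, |(D.count t ω : ℝ) - ⌊lam * t⌋₊| / t ∂P) atTop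
      (𝓝 (∫ _, 0 ∂P)) := by
    refine tendsto_integral_filter_of_dominated_convergence
      -- For `t ≥ 1`, dividing the linear bound on the count plus `lam * t` by `t` leaves at most
      -- this.
      (fun ω => 1 / c + 1 + |W ω| + lam) ?_ ?_ ?_ ?_
    · refine Eventually.of_forall fun t => ?_
      exact (((hD.integrable_count hlam t).sub (integrable_const _)).abs.div_const
        t).aestronglyMeasurable
    · filter_upwards [eventually_ge_atTop 1] with t ht
      filter_upwards [hle] with ω hω
      have ht0 : 0 < t := by linarith
      have h1 := hω t
      rw [abs_of_pos ht0] at h1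
      have h2 : (⌊lam * t⌋₊ : ℝ) ≤ lam * t := Nat.floor_le (by positivity)
      rw [Real.norm_of_nonneg (by positivity), div_le_iff₀ ht0]
      have h3 : |(D.count t ω : ℝ) - ⌊lam * t⌋₊| ≤ D.count t ω + ⌊lam * t⌋₊ := by
        refine (abs_sub _ _).trans_eq ?_
        rw [Nat.abs_cast, Nat.abs_cast]
      have h4 : (1 / c + 1 + |W ω| + lam) * t = t / c + t + |W ω| * t + lam * t := by ring
      rw [h4]
      nlinarith [le_abs_self (W ω), abs_nonneg (W ω)]
    · exact (((integrable_const _).add hW.abs).add (integrable_const _))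
    · filter_upwards [hD.inter_nonneg_ae, hD.tendsto_prior_div] with ω h0 h
      have h1 := tendsto_count_div h0 (by positivity) h
      have h2 := tendsto_nat_floor_mul_div_atTop hlam.le
      have h3 := (h1.sub h2).abs
      rw [one_div, inv_inv, sub_self, abs_zero] at h3
      refine h3.congr' ?_
      filter_upwards [eventually_gt_atTop 0] with t ht
      rw [← sub_div, abs_div, abs_of_pos ht]
  simpa [integral_div] using key

end Primitives

/-! ### Expected payments and the revenue rate. -/

namespace Primitives

variable {Ω : Type*} {K : ℕ} {D : Primitives Ω K} (p : Fin K → NNReal)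

open Classical in
/-- The payment of customer `n`. -/
noncomputable def payment (D : Primitives Ω K) (n : ℕ) (ω : Ω) : ℝ :=
  ∑ k : Fin K, if (p k : ℝ) ≤ D.val n ω ∧ D.seen p n ω = (k : ℕ) then (p k : ℝ) else 0

theorem revenue_eq_sum_payment (t : ℝ) (ω : Ω) :
    D.revenue p t ω = ∑ n ∈ Finset.range (D.count t ω), D.payment p n ω := rfl

theorem payment_nonneg (n : ℕ) (ω : Ω) : 0 ≤ D.payment p n ω :=
  Finset.sum_nonneg fun k _ => by split_ifs <;> simp

theorem payment_le (n : ℕ) (ω : Ω) : D.payment p n ω ≤ ∑ k, (p k : ℝ) :=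
  Finset.sum_le_sum fun k _ => by split_ifs <;> simp

theorem abs_sum_range_sub_sum_range_le {g : ℕ → ℝ} {C : ℝ} (h0 : ∀ n, 0 ≤ g n)
    (hC : ∀ n, g n ≤ C) (m n : ℕ) :
    |∑ i ∈ Finset.range m, g i - ∑ i ∈ Finset.range n, g i| ≤ C * |(m : ℝ) - n| := by
  wlog h : n ≤ m generalizing m n
  · rw [abs_sub_comm, abs_sub_comm (m : ℝ)]
    exact this n m (not_le.1 h).le
  have h1 : (n : ℝ) ≤ m := by exact_mod_cast h
  rw [← Finset.sum_Ico_eq_sub _ h, abs_of_nonneg (Finset.sum_nonneg fun i _ => h0 i),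
    abs_of_nonneg (by linarith)]
  refine (Finset.sum_le_card_nsmul _ _ C fun i _ => hC i).trans_eq ?_
  rw [Nat.card_Ico, nsmul_eq_mul, Nat.cast_sub h, mul_comm]

variable [mΩ : MeasurableSpace Ω] {P : Measure Ω} {lam mu : ℝ} {F G : Measure ℝ}

theorem IsModel.measurableSet_pays (hD : D.IsModel P lam mu F G) (n : ℕ) (k : Fin K) :
    MeasurableSet {ω | (p k : ℝ) ≤ D.val n ω ∧ D.seen p n ω = (k : ℕ)} :=
  (measurableSet_le measurable_const (hD.measurable (.val n))).inter
    (measurableSet_eq_fun (hD.measurable_seen p n) measurable_const)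

theorem IsModel.measurable_payment (hD : D.IsModel P lam mu F G) (n : ℕ) :
    Measurable (D.payment p n) :=
  Finset.measurable_fun_sum _ fun k _ =>
    Measurable.ite (hD.measurableSet_pays p n k) measurable_const measurable_const

variable [IsProbabilityMeasure P]

theorem IsModel.integrable_payment (hD : D.IsModel P lam mu F G) (n : ℕ) :
    Integrable (D.payment p n) P := by
  refine Integrable.of_bound (C := ∑ k, (p k : ℝ))
    (hD.measurable_payment p n).aestronglyMeasurable (Eventually.of_forall fun ω => ?_)
  rw [Real.norm_of_nonneg (payment_nonneg p n ω)]
  exact payment_le p n ω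

/-- The state seen by customer `n` is determined by sources of rank at most `3 * n + 1`, hence
independent of that customer's valuation. -/
theorem IsModel.measureReal_pays (hD : D.IsModel P lam mu F G) (n : ℕ) (k : Fin K) :
    P.real {ω | (p k : ℝ) ≤ D.val n ω ∧ D.seen p n ω = (k : ℕ)}
      = D.stateLaw p P n k.castSucc * tail G (p k) := by
  have hind := hD.indep_level (r := 3 * n + 1) (a := .val n) (by simp [Source.rank])
  have h1 : MeasurableSet[D.level (3 * n + 1)] {ω | D.seen p n ω = (k : ℕ)} :=
    @Primitives.measurable_seen _ _ (D.level (3 * n + 1)) D p _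
      (D.measurable_family_level (3 * n + 1)) n le_rfl _ (measurableSet_singleton (k : ℕ))
  have h2 : MeasurableSet[MeasurableSpace.comap (D.family (.val n)) inferInstance]
      {ω | (p k : ℝ) ≤ D.val n ω} := ⟨Set.Ici (p k : ℝ), measurableSet_Ici, rfl⟩
  have h3 : {ω | (p k : ℝ) ≤ D.val n ω ∧ D.seen p n ω = (k : ℕ)}
      = {ω | D.seen p n ω = (k : ℕ)} ∩ {ω | (p k : ℝ) ≤ D.val n ω} := by
    ext ω; exact and_comm
  rw [h3, measureReal_def, (Indep_iff _ _ _).1 hind _ _ h1 h2, hD.measure_le_val,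
    ENNReal.toReal_mul, ENNReal.toReal_ofReal (by
      unfold tail; linarith [cdf_le_one G (p k)])]
  rfl

theorem IsModel.integral_payment (hD : D.IsModel P lam mu F G) (n : ℕ) :
    ∫ ω, D.payment p n ω ∂P
      = ∑ k : Fin K, D.stateLaw p P n k.castSucc * tail G (p k) * (p k : ℝ) := by
  classical
  have h : ∀ k : Fin K, (fun ω => if (p k : ℝ) ≤ D.val n ω ∧ D.seen p n ω = (k : ℕ)
      then (p k : ℝ) else 0)
      = {ω | (p k : ℝ) ≤ D.val n ω ∧ D.seen p n ω = (k : ℕ)}.indicator fun _ => (p k : ℝ) := by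
    intro k; funext ω; simp [Set.indicator_apply]
  have h1 : D.payment p n = fun ω => ∑ k : Fin K,
      {ω | (p k : ℝ) ≤ D.val n ω ∧ D.seen p n ω = (k : ℕ)}.indicator (fun _ => (p k : ℝ)) ω := by
    funext ω
    refine Finset.sum_congr rfl fun k _ => ?_
    rw [← h k]
  rw [h1, integral_finsetSum _ fun k _ =>
    (integrable_const _).indicator (hD.measurableSet_pays p n k)]
  refine Finset.sum_congr rfl fun k _ => ?_
  rw [integral_indicator_const _ (hD.measurableSet_pays p n k), hD.measureReal_pays, smul_eq_mul]

theorem IsModel.integrable_revenue (hD : D.IsModel P lam mu F G) (hlam : 0 < lam) (t : ℝ) :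
    Integrable (D.revenue p t) P := by
  refine Integrable.mono' ((hD.integrable_count hlam t).const_mul (∑ k, (p k : ℝ)))
    (hD.aestronglyMeasurable_sum_count hlam (hD.measurable_payment p) t)
    (Eventually.of_forall fun ω => ?_)
  have h := abs_sum_range_sub_sum_range_le (fun n => payment_nonneg (D := D) p n ω)
    (fun n => payment_le p n ω) (D.count t ω) 0
  simpa [revenue_eq_sum_payment] using h

theorem IsModel.tendsto_revenue_rate (hD : D.IsModel P lam mu F G) (hlam : 0 < lam)
    (hmu : 0 < mu) {π : Fin (K + 1) → ℝ} (hπ : IsStationary (transition mu F G p) π) :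
    Tendsto (fun t : ℝ => (∫ ω, D.revenue p t ω ∂P) / t) atTop
      (𝓝 (∑ k : Fin K, π k.castSucc * (lam * tail G (p k)) * (p k : ℝ))) := by
  set C := ∑ k, (p k : ℝ) with hC
  set ℓ := ∑ k : Fin K, π k.castSucc * tail G (p k) * (p k : ℝ) with hℓ
  have hpay : Tendsto (fun n => ∫ ω, D.payment p n ω ∂P) atTop (𝓝 ℓ) := by
    simp only [hD.integral_payment p]
    exact tendsto_finsetSum _ fun k _ =>
      ((hD.tendsto_stateLaw p hlam hmu hπ k.castSucc).mul_const _).mul_const _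
  have hfloor : Tendsto (fun t : ℝ => ⌊lam * t⌋₊) atTop atTop :=
    tendsto_nat_floor_atTop.comp (tendsto_id.const_mul_atTop hlam)
  have hmain : Tendsto (fun t : ℝ => (∑ n ∈ Finset.range ⌊lam * t⌋₊, ∫ ω, D.payment p n ω ∂P) / t)
      atTop (𝓝 (lam * ℓ)) := by
    refine ((tendsto_nat_floor_mul_div_atTop hlam.le).mul
      (hpay.cesaro.comp hfloor)).congr' ?_
    filter_upwards [hfloor.eventually_ne_atTop 0] with t ht
    have : (⌊lam * t⌋₊ : ℝ) ≠ 0 := by exact_mod_cast ht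
    simp only [Function.comp_apply]
    field_simp
  -- The random number of payments is exchanged for a deterministic one; no independence between
  -- count and payments is involved.
  have hdiff : Tendsto (fun t : ℝ => (∫ ω, D.revenue p t ω ∂P) / t -
      (∑ n ∈ Finset.range ⌊lam * t⌋₊, ∫ ω, D.payment p n ω ∂P) / t) atTop (𝓝 0) := by
    have hlim := (hD.tendsto_integral_abs_count_sub hlam).const_mul C
    rw [mul_zero] at hlim
    refine squeeze_zero_norm' ?_ hlim
    filter_upwards [eventually_gt_atTop 0] with t ht
    have hint : Integrable (fun ω => ∑ n ∈ Finset.range ⌊lam * t⌋₊, D.payment p n ω) P :=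
      integrable_finsetSum _ fun n _ => hD.integrable_payment p n
    rw [← integral_finsetSum _ fun n _ => hD.integrable_payment p n, ← sub_div,
      ← integral_sub (hD.integrable_revenue p hlam t) hint, norm_div, Real.norm_of_nonneg ht.le,
      ← mul_div_assoc, ← integral_const_mul]
    refine div_le_div_of_nonneg_right ((norm_integral_le_integral_norm _).trans
      (integral_mono ((hD.integrable_revenue p hlam t).sub hint).norm
        (((hD.integrable_count hlam t).sub (integrable_const _)).abs.const_mul C)
        fun ω => ?_)) ht.le
    exact abs_sum_range_sub_sum_range_le (fun n => payment_nonneg p n ω)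
      (fun n => payment_le p n ω) _ _
  have hsum : ∑ k : Fin K, π k.castSucc * (lam * tail G (p k)) * (p k : ℝ) = 0 + lam * ℓ := by
    rw [zero_add, hℓ, Finset.mul_sum]
    exact Finset.sum_congr rfl fun k _ => by ring
  rw [hsum]
  exact (hdiff.add hmain).congr fun t => by ring

end Primitives

end LossPricing

theorem mainTheorem7 {Ω : Type*} [MeasurableSpace Ω] (P : Measure Ω) [IsProbabilityMeasure P]
    (K : ℕ) (lam mu : ℝ) (hlam : 0 < lam) (hmu : 0 < mu)
    (F G : Measure ℝ) (D : LossPricing.Primitives Ω K) (hD : D.IsModel P lam mu F G)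
    (p : Fin K → NNReal) :
    LossPricing.IsMarkovChain P (D.seen p) (LossPricing.transition mu F G p) ∧
    (∃! π : Fin (K + 1) → ℝ,
      LossPricing.IsStationary (LossPricing.transition mu F G p) π) ∧
    (∀ t : ℝ, Integrable (D.revenue p t) P) ∧
    ∀ π : Fin (K + 1) → ℝ, LossPricing.IsStationary (LossPricing.transition mu F G p) π →
      Tendsto (fun t : ℝ => (∫ ω, D.revenue p t ω ∂P) / t) atTop
        (𝓝 (∑ k : Fin K, π k.castSucc * (lam * LossPricing.tail G (p k)) * (p k : ℝ))) := by
  exact ⟨hD.isMarkovChain_seen p hmu, hD.existsUnique_isStationary p hlam hmu,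
    hD.integrable_revenue p hlam, fun _ hπ => hD.tendsto_revenue_rate p hlam hmu hπ⟩
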